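/- **Setting.** Let $G=(V,E)$ be a finite, simple, undirected, connected graph with at least two vertices and weights $\omega_{ij}=\omega_{ji}\ge 0$, where $\omega_{ij}>0$ if and only if $ij\in E$ (so $\omega_{ii}=0$). Put $d_i=\sum_j\omega_{ij}$ and fix $r\in[0,1]$. Let $\mathcal V=\{u:V\to\mathbb R\}$, with $\langle u,v\rangle_{\mathcal V}=\sum_i u_iv_id_i^r$ and $\|u\|_{\mathcal V}=\langle u,u\rangle_{\mathcal V}^{1/2}$, and for $X\subseteq\mathbb R$ let $\mathcal V_X=\{u:V\to X\}$. For functions on $V\times V$ let $\langle\varphi,\phi\rangle_{\mathcal E}=\frac12\sum_{i,j}\varphi_{ij}\phi_{ij}\omega_{ij}$, with norm $\|\cdot\|_{\mathcal E}$. Let $(\nabla u)_{ij}=u_j-u_i$ for $ij\in E$ and $0$ otherwise, and $(\Delta u)_i=d_i^{-r}\sum_j\omega_{ij}(u_i-u_j)$. Let $\varepsilon>0$, $\mu\in\mathcal V_{[0,\infty)}\setminus\{\mathbf 0\}$, $\tilde f\in\mathcal V_{[0,1]}$, $M=\operatorname{diag}(\mu)$, $A=\Delta+M$, $f=M\tilde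 f$, $B=A-\varepsilon^{-1}I$, and let $\sigma(A)$ be the set of eigenvalues of $A$. Let $W(x)=\frac12x(1-x)$ for $x\in[0,1]$ and $W(x)=\infty$ otherwise, and $$\mathrm{GL}_{\varepsilon,\mu,\tilde f}(u)=\tfrac12\|\nabla u\|_{\mathcal E}^2+\tfrac1\varepsilon\langle W\circ u,\mathbf 1\rangle_{\mathcal V}+\tfrac12\langle u-\tilde f,M(u-\tilde f)\rangle_{\mathcal V}.$$ For $u\in\mathcal V$ let $\mathcal B(u)=\{\alpha\in\mathcal V:\alpha_i\in-\partial I_{[0,1]}(u_i)\ \forall i\in V\}$, where $I_{[0,1]}$ is $0$ on $[0,1]$ and $\infty$ elsewhere. That is, $\mathcal B(u)=\emptyset$ if $u\notin\mathcal V_{[0,1]}$, and otherwise $\alpha\in\mathcal B(u)$ means $\alpha_i\ge0$ where $u_i=0$, $\alpha_i=0$ where $0<u_i<1$, and $\alpha_i\le0$ where $u_i=1$. Let $T=[0,T_0]$ with $T_0\ge0$, or $T=[0,\infty)$. Let $H^1_{loc}(T;\mathcal V)$ be the set of $u:T\to\mathcal V$ with $u\in H^1((a,b);\mathcal V)$ for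 all $a,b\in T$; $\frac{du}{dt}$ is the weak derivative. Call $u$ *admissible* if $u\in H^1_{loc}(T;\mathcal V)\cap C^0(T;\mathcal V)$ and $u(t)\in\mathcal V_{[0,1]}$ for all $t\in T$. A pair $(u,\beta)$ of functions $T\to\mathcal V$ is a *solution* (of the double-obstacle Allen–Cahn equation with fidelity forcing) if $u$ is admissible and for a.e. $t\in T$ $$\varepsilon\tfrac{du}{dt}(t)+\varepsilon Au(t)-\varepsilon f+\tfrac12\mathbf 1-u(t)=\beta(t),\qquad\beta(t)\in\mathcal B(u(t)).\tag{1}$$ **Theorem 2.4.** The following hold. (a) (Existence) For every $u_0\in\mathcal V_{[0,1]}$ there is a solution $(u,\beta)$ with $u(0)=u_0$. (b) (Comparison principle) Let $u,v$ be admissible and $\beta,\gamma:T\to\mathcal V$. Suppose that vertexwise, for a.e. $t\in T$, $$\varepsilon\tfrac{du}{dt}(t)+\varepsilon Au(t)-\varepsilon f+\tfrac12\mathbf 1-u(t)\ge\beta(t),\quad\beta(t)\in\mathcal B(u(t)),$$ $$\varepsilon\tfrac{dv}{dt}(t)+\varepsilon Av(t)-\varepsilon f+\tfrac12\mathbf 1-v(t)\le\gamma(t),\quad\gamma(t)\in\mathcal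 B(v(t)),$$ and $v(0)\le u(0)$ vertexwise. Then $v(t)\le u(t)$ vertexwise for all $t\in T$. (c) (Uniqueness) If $(u,\beta)$ and $(v,\gamma)$ are solutions with $u(0)=v(0)$, then $u(t)=v(t)$ for all $t\in T$ and $\beta(t)=\gamma(t)$ for a.e. $t\in T$. (d) (Gradient flow) If $(u,\beta)$ is a solution, then $t\mapsto\mathrm{GL}_{\varepsilon,\mu,\tilde f}(u(t))$ is monotonically decreasing (non-increasing) on $T$. (e) (Weak form) Let $u$ be admissible. Then the following are equivalent: (i) $(u,\beta)$ is a solution for some $\beta$; (ii) $(u,\beta)$ is a solution for every $\beta$ with $\beta(t)=\varepsilon\frac{du}{dt}(t)+\varepsilon Au(t)-\varepsilon f+\frac12\mathbf 1-u(t)$ a.e.; (iii) for a.e. $t\in T$ and all $\eta\in\mathcal V_{[0,1]}$, $$\left\langle\varepsilon\tfrac{du}{dt}(t)+\varepsilon Au(t)-\varepsilon f+\tfrac12\mathbf 1-u(t),\ \eta-u(t)\right\rangle_{\mathcal V}\ge0.$$ (f) (Explicit form) Suppose $\varepsilon^{-1}\notin\sigma(A)$. Let $u:T\to\mathcal V_{[0,1]}$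 and $\beta:T\to\mathcal V$. Then $(u,\beta)$ is a solution if and only if $\beta(t)\in\mathcal B(u(t))$ and $\beta(t)\in\mathcal V_{[-1/2,1/2]}$ for a.e. $t\in T$, $\beta$ is integrable on $[0,t]$ for every $t\in T$, and for every $t\in T$ $$u(t)=e^{-tB}u(0)+B^{-1}(I-e^{-tB})\left(f-\tfrac1{2\varepsilon}\mathbf 1\right)+\tfrac1\varepsilon\int_0^te^{-(t-s)B}\beta(s)\,ds.$$ (g) (Lipschitz regularity) If $\varepsilon^{-1}\notin\sigma(A)$ and $(u,\beta)$ is a solution, then $u\in C^{0,1}(T;\mathcal V)$, i.e. there is $K$ with $\|u(t)-u(s)\|_{\mathcal V}\le K|t-s|$ for all $s,t\in T$. (h) (Well-posedness) If $\varepsilon^{-1}\notin\sigma(A)$, then $\xi_1:=\min\sigma(A)$ exists, and for all $u_0,v_0\in\mathcal V_{[0,1]}$, all solutions $(u,\beta)$, $(v,\gamma)$ with $u(0)=u_0$, $v(0)=v_0$, and all $t\in T$, $$\|u(t)-v(t)\|_{\mathcal V}\le e^{-\xi_1t}e^{t/\varepsilon}\|u_0-v_0\|_{\mathcal V}.$$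 -/

import Mathlib

open MeasureTheory

open scoped Matrix ContDiff

noncomputable section

namespace GraphACE

/-- A finite (through `[Fintype V]` below), simple, undirected, weighted, connected graph without
self-loops.  The weight `wt i j = ω_ij` is positive exactly on edges, so that `wt i i = 0`. -/
structure WGraph (V : Type*) where
  graph : SimpleGraph V
  connected : graph.Connected
  wt : V → V → ℝ
  nonneg : ∀ i j, 0 ≤ wt i j
  symm : ∀ i j, wt i j = wt j i
  pos_iff : ∀ i j, 0 < wt i j ↔ graph.Adj i j

variable {V : Type*} [Fintype V]

/-- The degree `d_i = ∑_j ω_ij`. -/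
def WGraph.deg (G : WGraph V) (i : V) : ℝ := ∑ j, G.wt i j

/-- The inner product `⟨u, v⟩_𝒱 = ∑_i u_i v_i d_i ^ r` of vertex functions. -/
def ipV (G : WGraph V) (r : ℝ) (u v : V → ℝ) : ℝ := ∑ i, u i * v i * G.deg i ^ r

/-- The norm `‖u‖_𝒱`. -/
def normV (G : WGraph V) (r : ℝ) (u : V → ℝ) : ℝ := √(ipV G r u u)

/-- The inner product `⟨φ, ψ⟩_ℰ = (1/2) ∑_{i,j} φ_ij ψ_ij ω_ij` of edge functions. -/
def ipE (G : WGraph V) (φ ψ : V → V → ℝ) : ℝ := 1 / 2 * ∑ i, ∑ j, φ i j * ψ i j * G.wt i j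

/-- The norm `‖φ‖_ℰ`. -/
def normE (G : WGraph V) (φ : V → V → ℝ) : ℝ := √(ipE G φ φ)

open Classical in
/-- The graph gradient. -/
def grad (G : WGraph V) (u : V → ℝ) (i j : V) : ℝ := if G.graph.Adj i j then u j - u i else 0

/-- The set `𝒱_[0,1]`. -/
def unitBox (V : Type*) : Set (V → ℝ) := {u | ∀ i, u i ∈ Set.Icc (0 : ℝ) 1}

section Operators

variable [DecidableEq V]

/-- The graph Laplacian `Δ = D^{-r} (D - ω)`, as a matrix. -/
def lap (G : WGraph V) (r : ℝ) : Matrix V V ℝ :=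
  Matrix.diagonal (fun i => G.deg i ^ (-r)) * (Matrix.diagonal G.deg - Matrix.of G.wt)

theorem lap_mulVec (G : WGraph V) (r : ℝ) (u : V → ℝ) (i : V) :
    (lap G r *ᵥ u) i = G.deg i ^ (-r) * ∑ j, G.wt i j * (u i - u j) := by
  rw [lap, ← Matrix.mulVec_mulVec, Matrix.mulVec_diagonal, Matrix.sub_mulVec, Pi.sub_apply,
    Matrix.mulVec_diagonal]
  simp only [Matrix.mulVec, dotProduct, Matrix.of_apply, mul_sub, Finset.sum_sub_distrib]
  rw [← Finset.sum_mul]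
  rfl

/-- `M = diag(μ)`. -/
def fidM (μ : V → ℝ) : Matrix V V ℝ := Matrix.diagonal μ

/-- `A = Δ + M`. -/
def opA (G : WGraph V) (r : ℝ) (μ : V → ℝ) : Matrix V V ℝ := lap G r + fidM μ

/-- `B = A - ε⁻¹ I`. -/
def opB (G : WGraph V) (r ε : ℝ) (μ : V → ℝ) : Matrix V V ℝ := opA G r μ - ε⁻¹ • (1 : Matrix V V ℝ)

/-- `σ(F)`, the set of eigenvalues of `F`. -/
def eigs (F : Matrix V V ℝ) : Set ℝ := {l | Module.End.HasEigenvalue (Matrix.toLin' F) l}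

/-- `f = M f̃`. -/
def fidf (μ ft : V → ℝ) : V → ℝ := fidM μ *ᵥ ft

/-- The left-hand side `ε u' + ε A u - ε f + (1/2) 𝟏 - u` of the equation, where `u'` stands for
the time derivative. -/
def aceLHS (G : WGraph V) (r ε : ℝ) (μ ft u u' : V → ℝ) : V → ℝ :=
  ε • u' + ε • (opA G r μ *ᵥ u) - ε • fidf μ ft + (1 / 2 : ℝ) • (1 : V → ℝ) - u

end Operators

/-- The subdifferential of an extended-real-valued function on `ℝ`. -/
def subdiff (F : ℝ → EReal) (x : ℝ) : Set ℝ :=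
  {p | ∀ y : ℝ, F x + ((p * (y - x) : ℝ) : EReal) ≤ F y}

open Classical in
/-- The indicator `I_[0,1]` of convex analysis. -/
def indI (x : ℝ) : EReal := if x ∈ Set.Icc (0 : ℝ) 1 then 0 else ⊤

/-- The set `ℬ(u) = {α | ∀ i, α_i ∈ -∂I_[0,1](u_i)}`. -/
def setB (u : V → ℝ) : Set (V → ℝ) := {α | ∀ i, -α i ∈ subdiff indI (u i)}

/-- The explicit description of `-∂I_[0,1]`. -/
theorem neg_mem_subdiff_indI {a x : ℝ} :
    -a ∈ subdiff indI x ↔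
      x ∈ Set.Icc (0 : ℝ) 1 ∧ (x < 1 → 0 ≤ a) ∧ (0 < x → a ≤ 0) := by
  constructor
  · intro h
    have hx : x ∈ Set.Icc (0 : ℝ) 1 := by
      by_contra hx
      have h0 := h 0
      rw [indI, if_neg hx, EReal.top_add_coe, indI, if_pos (by simp)] at h0
      exact absurd h0 (by simp)
    have key : ∀ y ∈ Set.Icc (0 : ℝ) 1, -a * (y - x) ≤ 0 := by
      intro y hy
      have h1 := h y
      rw [indI, if_pos hx, indI, if_pos hy, zero_add] at h1
      exact_mod_cast h1
    refine ⟨hx, fun h1 => ?_, fun h0 => ?_⟩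
    · have := key 1 (by simp)
      nlinarith
    · have := key 0 (by simp)
      nlinarith
  · rintro ⟨hx, h1, h0⟩ y
    rw [indI, if_pos hx, zero_add, indI]
    split_ifs with hy
    · have : -a * (y - x) ≤ 0 := by
        rcases lt_or_ge x 1 with h | h
        · rcases lt_or_ge 0 x with h' | h'
          · have := le_antisymm (h0 h') (h1 h)
            simp [this]
          · have := h1 h
            nlinarith [hy.1]
        · have := h0 (by linarith)
          nlinarith [hy.2]
      exact_mod_cast this
    · exact le_top

open Classical in
/-- The double-obstacle potential, with value `∞` outside `[0,1]`. -/
def potW (x : ℝ) : EReal := if x ∈ Set.Icc (0 : ℝ) 1 then ((1 / 2 * x * (1 - x) : ℝ) : EReal) else ⊤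

/-- The Ginzburg-Landau energy with fidelity term,
`(1/2) ‖∇u‖_ℰ² + ε⁻¹ ⟨W ∘ u, 𝟏⟩_𝒱 + (1/2) ⟨u - f̃, M (u - f̃)⟩_𝒱`. -/
def energy [DecidableEq V] (G : WGraph V) (r ε : ℝ) (μ ft u : V → ℝ) : EReal :=
  ((1 / 2 * normE G (grad G u) ^ 2 : ℝ) : EReal)
    + ((1 / ε : ℝ) : EReal) * ∑ i, potW (u i) * ((G.deg i ^ r : ℝ) : EReal)
    + ((1 / 2 * ipV G r (u - ft) (fidM μ *ᵥ (u - ft)) : ℝ) : EReal)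

/-- On the open interval `(a,b)`, `u ∈ H¹((a,b); 𝒱)` with weak derivative `u'`: both lie in
`L²((a,b); 𝒱)` and the integration-by-parts formula holds against every test function in
`C_c^∞((a,b); 𝒱)`.  All norms on the finite-dimensional space `𝒱` give the same space `L²`. -/
def HasWeakDerivOn (G : WGraph V) (r a b : ℝ) (u u' : ℝ → V → ℝ) : Prop :=
  MemLp u 2 (volume.restrict (Set.Ioo a b)) ∧ MemLp u' 2 (volume.restrict (Set.Ioo a b)) ∧
    ∀ φ : ℝ → V → ℝ, ContDiff ℝ ∞ φ → HasCompactSupport φ → tsupport φ ⊆ Set.Ioo a b →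
      ∫ t in Set.Ioo a b, ipV G r (u t) (deriv φ t) =
        -∫ t in Set.Ioo a b, ipV G r (u' t) (φ t)

/-- `u ∈ H¹_loc(T; 𝒱)` with weak derivative `u'` (which is unique up to null sets of `T`):
`u ∈ H¹((a,b); 𝒱)` with weak derivative `u'` for all `a, b ∈ T`. -/
def HasWeakDerivLoc (G : WGraph V) (r : ℝ) (T : Set ℝ) (u u' : ℝ → V → ℝ) : Prop :=
  ∀ a ∈ T, ∀ b ∈ T, HasWeakDerivOn G r a b u u'

/-- `u ∈ 𝒱_{[0,1], t ∈ T} ∩ H¹_loc(T; 𝒱) ∩ C⁰(T; 𝒱)`, with weak derivative `u'`.  Functions on `T`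
are represented by functions on `ℝ`, whose values off `T` play no role. -/
def IsTrajectory (G : WGraph V) (r : ℝ) (T : Set ℝ) (u u' : ℝ → V → ℝ) : Prop :=
  (∀ t ∈ T, u t ∈ unitBox V) ∧ ContinuousOn u T ∧ HasWeakDerivLoc G r T u u'

/-- `(u, β)` is a solution to the double-obstacle Allen-Cahn equation with fidelity forcing
on `T`. -/
def IsSolution [DecidableEq V] (G : WGraph V) (r ε : ℝ) (μ ft : V → ℝ) (T : Set ℝ)
    (u β : ℝ → V → ℝ) : Prop :=
  ∃ u' : ℝ → V → ℝ, IsTrajectory G r T u u' ∧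
    ∀ᵐ t ∂(volume.restrict T),
      aceLHS G r ε μ ft (u t) (u' t) = β t ∧ β t ∈ setB (u t)

/-- The variational inequality `⟨ε u' + ε A u - ε f + (1/2) 𝟏 - u, η - u⟩_𝒱 ≥ 0` for a.e. `t ∈ T`
and all `η ∈ 𝒱_[0,1]`. -/
def IsWeakForm [DecidableEq V] (G : WGraph V) (r ε : ℝ) (μ ft : V → ℝ) (T : Set ℝ)
    (u u' : ℝ → V → ℝ) : Prop :=
  ∀ᵐ t ∂(volume.restrict T), ∀ η ∈ unitBox V,
    0 ≤ ipV G r (aceLHS G r ε μ ft (u t) (u' t)) (η - u t)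

/-- The right-hand side of the explicit (Duhamel) formula at time `t`. -/
def duhamel [DecidableEq V] (G : WGraph V) (r ε : ℝ) (μ ft u₀ : V → ℝ) (β : ℝ → V → ℝ) (t : ℝ) :
    V → ℝ :=
  NormedSpace.exp (-t • opB G r ε μ) *ᵥ u₀
    + ((opB G r ε μ)⁻¹ * (1 - NormedSpace.exp (-t • opB G r ε μ))) *ᵥ
        (fidf μ ft - (1 / (2 * ε)) • (1 : V → ℝ))
    + (1 / ε) • ∫ s in (0 : ℝ)..t, NormedSpace.exp (-(t - s) • opB G r ε μ) *ᵥ β s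

end GraphACE

end

open GraphACE

open GraphACE

noncomputable section

namespace GraphACE

open Set Filter Topology

/-! ### Absolutely continuous functions and their a.e. derivatives. -/

section

/-! By the du Bois-Reymond lemma, each coordinate of an admissible curve is absolutely continuous on
compact intervals, and its weak derivative is the a.e. classical one (`IsTrajectory.acd`). Hence
pointwise a.e. differential inequalities can be integrated. Moreover, at almost every time at which
a coordinate sits on an obstacle 0 or 1, its derivative vanishes, since it is at an extremum in time
(`IsTrajectory.ae_deriv_eq_zero`).

The set `setB u` is the negative of the normal cone of the box at `u`, which makes the equation
equivalent to the variational inequality (`mem_setB_iff_ipV`). Existence comes from a projected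
Euler scheme: its discrete evolution variational inequality passes to a pointwise limit given by
Tychonoff compactness (`exists_evi_curve`), and differentiating the limit inequality in time yields
the weak form.

Comparison is Gronwall's inequality for the weighted sum of the squares of `max (v i - u i) 0`:
where this is positive, the multipliers have favourable signs and the Laplacian is monotone
(`sum_posPart_mul_deriv_le`). Uniqueness is comparison in both directions. The energy has derivative
minus the squared norm of the velocity, because multiplier times velocity vanishes a.e. On the
obstacles the velocity is zero, so the equation gives the multiplier explicitly and bounds it by
1/2; this bounds the velocity and gives the Lipschitz estimate. Well-posedness combines monotonicity
of the subdifferential, the Rayleigh bound by the least eigenvalue of `A` (`exists_isLeast_eigs`)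
and Gronwall. The explicit form is variation of constants with integrating factor `exp (t • B)`,
used in both directions. -/

/-- `f` is absolutely continuous on the interval with endpoints `a`, `b`, with a.e. derivative
`f'`. -/
def ACD (f f' : ℝ → ℝ) (a b : ℝ) : Prop :=
  AbsolutelyContinuousOnInterval f a b ∧ ∀ᵐ t, t ∈ uIcc a b → HasDerivAt f (f' t) t

theorem ae_ne_real (a : ℝ) : ∀ᵐ t : ℝ, t ≠ a := by simp [ae_iff, measure_singleton]

theorem AbsolutelyContinuousOnInterval.congr_uIcc {f g : ℝ → ℝ} {a b : ℝ}
    (hf : AbsolutelyContinuousOnInterval f a b) (h : EqOn f g (uIcc a b)) :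
    AbsolutelyContinuousOnInterval g a b := by
  rw [absolutelyContinuousOnInterval_iff] at hf ⊢
  intro ε hε
  obtain ⟨δ, hδ, H⟩ := hf ε hε
  refine ⟨δ, hδ, fun E hE hE' => ?_⟩
  convert H E hE hE' using 1
  refine Finset.sum_congr rfl fun i hi => ?_
  have := hE.1 i hi
  rw [h this.1, h this.2]

namespace ACD

variable {f g f' g' : ℝ → ℝ} {a b : ℝ}

theorem congr (hf : ACD f f' a b) (h : EqOn f g (uIcc a b)) : ACD g f' a b := by
  refine ⟨AbsolutelyContinuousOnInterval.congr_uIcc hf.1 h, ?_⟩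
  filter_upwards [hf.2, ae_ne_real a, ae_ne_real b] with t ht hta htb hmem
  refine (ht hmem).congr_of_eventuallyEq ?_
  -- Agreement on the closed interval transfers derivatives only at interior points; the two
  -- endpoints form a null set.
  have : Icc (min a b) (max a b) ∈ 𝓝 t := by
    rw [uIcc, mem_Icc] at hmem
    apply Icc_mem_nhds
    · refine lt_of_le_of_ne hmem.1 ?_
      rcases min_choice a b with h | h <;> rw [h] <;> exact Ne.symm ‹_›
    · refine lt_of_le_of_ne hmem.2 ?_
      rcases max_choice a b with h | h <;> rw [h] <;> assumption
  filter_upwards [this] with s hs using (h hs).symm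

theorem congr_deriv (hf : ACD f f' a b) (h : ∀ᵐ t, t ∈ uIcc a b → f' t = g' t) :
    ACD f g' a b := by
  refine ⟨hf.1, ?_⟩
  filter_upwards [hf.2, h] with t h1 h2 hm
  exact h2 hm ▸ h1 hm

theorem mono (hf : ACD f f' a b) {c d : ℝ} (h : uIcc c d ⊆ uIcc a b) : ACD f f' c d :=
  ⟨hf.1.mono h, hf.2.mono fun _ ht hm => ht (h hm)⟩

theorem deriv_ae (hf : ACD f f' a b) : ∀ᵐ t, t ∈ uIcc a b → deriv f t = f' t := by
  filter_upwards [hf.2] with t ht hm using (ht hm).deriv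

theorem intervalIntegrable (hf : ACD f f' a b) : IntervalIntegrable f' volume a b := by
  refine hf.1.intervalIntegrable_deriv.congr_ae ?_
  rw [Filter.EventuallyEq, ae_restrict_iff' measurableSet_uIoc]
  filter_upwards [hf.deriv_ae] with t ht hm using ht (uIoc_subset_uIcc hm)

theorem integral_eq (hf : ACD f f' a b) : ∫ t in a..b, f' t = f b - f a := by
  rw [← hf.1.integral_deriv_eq_sub]
  refine intervalIntegral.integral_congr_ae ?_
  filter_upwards [hf.deriv_ae] with t ht hm using (ht (uIoc_subset_uIcc hm)).symm

theorem continuousOn (hf : ACD f f' a b) : ContinuousOn f (uIcc a b) := hf.1.continuousOn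

theorem const (c a b : ℝ) : ACD (fun _ => c) (fun _ => 0) a b :=
  ⟨((LipschitzWith.const c).lipschitzOnWith (s := uIcc a b)).absolutelyContinuousOnInterval,
    .of_forall fun t _ => hasDerivAt_const t c⟩

theorem of_contDiff (hf : ContDiff ℝ 1 f) (h : ∀ t, HasDerivAt f (f' t) t) : ACD f f' a b :=
  ⟨hf.contDiffOn.absolutelyContinuousOnInterval, .of_forall fun t _ => h t⟩

theorem add (hf : ACD f f' a b) (hg : ACD g g' a b) :
    ACD (fun t => f t + g t) (fun t => f' t + g' t) a b := by
  refine ⟨hf.1.fun_add hg.1, ?_⟩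
  filter_upwards [hf.2, hg.2] with t h1 h2 hm using (h1 hm).add (h2 hm)

theorem sub (hf : ACD f f' a b) (hg : ACD g g' a b) :
    ACD (fun t => f t - g t) (fun t => f' t - g' t) a b := by
  refine ⟨hf.1.fun_sub hg.1, ?_⟩
  filter_upwards [hf.2, hg.2] with t h1 h2 hm using (h1 hm).sub (h2 hm)

theorem mul (hf : ACD f f' a b) (hg : ACD g g' a b) :
    ACD (fun t => f t * g t) (fun t => f' t * g t + f t * g' t) a b := by
  refine ⟨hf.1.mul hg.1, ?_⟩
  filter_upwards [hf.2, hg.2] with t h1 h2 hm using (h1 hm).mul (h2 hm)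

theorem const_mul (c : ℝ) (hf : ACD f f' a b) :
    ACD (fun t => c * f t) (fun t => c * f' t) a b := by
  refine ⟨hf.1.const_mul c, ?_⟩
  filter_upwards [hf.2] with t h1 hm using (h1 hm).const_mul c

theorem sum {ι : Type*} (s : Finset ι) {f f' : ι → ℝ → ℝ} (h : ∀ i ∈ s, ACD (f i) (f' i) a b) :
    ACD (fun t => ∑ i ∈ s, f i t) (fun t => ∑ i ∈ s, f' i t) a b := by
  classical
  induction s using Finset.induction_on with
  | empty => simpa using ACD.const 0 a b
  | insert i s hi ih =>
    simp only [Finset.sum_insert hi]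
    exact (h i (Finset.mem_insert_self i s)).add
      (ih fun j hj => h j (Finset.mem_insert_of_mem hj))

theorem sq (hf : ACD f f' a b) : ACD (fun t => f t ^ 2) (fun t => 2 * f t * f' t) a b := by
  have := hf.mul hf
  convert! this using 2 <;> ring

/-- The square of the positive part. -/
theorem posPart_sq (hf : ACD f f' a b) :
    ACD (fun t => max (f t) 0 ^ 2) (fun t => 2 * max (f t) 0 * f' t) a b := by
  -- The positive part is 1-Lipschitz, so the same `δ` works.
  have hmax : AbsolutelyContinuousOnInterval (fun t => max (f t) 0) a b := by
    have h0 := hf.1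
    rw [absolutelyContinuousOnInterval_iff] at h0 ⊢
    intro ε hε
    obtain ⟨δ, hδ, H⟩ := h0 ε hε
    refine ⟨δ, hδ, fun E hE hE' => (Finset.sum_le_sum fun i _ => ?_).trans_lt (H E hE hE')⟩
    simpa [Real.dist_eq] using abs_max_sub_max_le_max (f (E.2 i).1) 0 (f (E.2 i).2) 0
  refine ⟨(hmax.fun_mul hmax).congr_uIcc fun t _ => (_root_.sq _).symm, ?_⟩
  filter_upwards [hf.2] with t h1 hm
  -- Squaring removes the kink at 0, so the chain rule needs no exceptional set where `f` vanishes.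
  have key : HasDerivAt (fun x : ℝ => max x 0 ^ 2) (2 * max (f t) 0) (f t) := by
    rcases lt_trichotomy (f t) 0 with h | h | h
    · rw [max_eq_right h.le, mul_zero]
      refine (hasDerivAt_const (f t) (0 : ℝ)).congr_of_eventuallyEq ?_
      filter_upwards [Iio_mem_nhds h] with x hx
      rw [max_eq_right (le_of_lt hx)]; simp
    · rw [h, max_self, mul_zero, hasDerivAt_iff_isLittleO]
      simp only [max_self, sub_zero, smul_zero, zero_pow two_ne_zero]
      rw [Asymptotics.isLittleO_iff]
      intro c hc
      filter_upwards [Metric.ball_mem_nhds (0 : ℝ) hc] with x hx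
      have hx' : |x| < c := by simpa using hx
      have h2 : max x 0 ^ 2 ≤ |x| ^ 2 := by
        have : max x 0 ≤ |x| := max_le (le_abs_self x) (abs_nonneg x)
        exact pow_le_pow_left₀ (le_max_right _ _) this 2
      rw [Real.norm_of_nonneg (by positivity), Real.norm_eq_abs]
      nlinarith [abs_nonneg x]
    · rw [max_eq_left h.le]
      have h2 : HasDerivAt (fun x : ℝ => x ^ 2) (2 * f t) (f t) := by
        simpa using hasDerivAt_pow 2 (f t)
      refine h2.congr_of_eventuallyEq ?_
      filter_upwards [Ioi_mem_nhds h] with x hx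
      rw [max_eq_left (le_of_lt hx)]
  exact key.comp t (h1 hm)

theorem of_primitive (h' : IntervalIntegrable f' volume a b)
    (h : ∀ t ∈ uIcc a b, f t = f a + ∫ s in a..t, f' s) : ACD f f' a b := by
  have : ACD (fun t => ∫ s in a..t, f' s) f' a b := by
    refine ⟨h'.absolutelyContinuousOnInterval_intervalIntegral left_mem_uIcc, ?_⟩
    filter_upwards [h'.ae_hasDerivAt_integral] with t ht hm using ht hm a left_mem_uIcc
  have h2 := (ACD.const (f a) a b).add this
  simp only [zero_add] at h2
  exact h2.congr fun t ht => (h t ht).symm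

theorem le_of_deriv_nonpos (hf : ACD f f' a b) (hab : a ≤ b)
    (h : ∀ᵐ t, t ∈ Icc a b → f' t ≤ 0) : f b ≤ f a := by
  have h1 := hf.integral_eq
  have h2 : ∫ t in a..b, f' t ≤ 0 := by
    rw [intervalIntegral.integral_of_le hab]
    refine integral_nonpos_of_ae ?_
    rw [Filter.EventuallyLE, ae_restrict_iff' measurableSet_Ioc]
    filter_upwards [h] with t ht hm using ht (Ioc_subset_Icc_self hm)
  linarith

/-- Integration by parts against a test function. -/
theorem integral_mul_test (hf : ACD f f' a b) (hab : a ≤ b) {φ : ℝ → ℝ} (hφ : ContDiff ℝ ∞ φ)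
    (hs : tsupport φ ⊆ Ioo a b) :
    ∫ t in Ioo a b, f t * deriv φ t = -∫ t in Ioo a b, f' t * φ t := by
  have hφd : ACD φ (deriv φ) a b :=
    .of_contDiff (hφ.of_le (by exact_mod_cast le_top)) fun t =>
      (hφ.differentiable (by simp) t).hasDerivAt
  have h := (hf.mul hφd).integral_eq
  have h0 : ∀ x, x ∉ Ioo a b → φ x = 0 := fun x hx => by
    by_contra hne
    exact hx (hs (subset_tsupport φ hne))
  rw [h0 a (by simp), h0 b (by simp), intervalIntegral.integral_add] at h
  · rw [intervalIntegral.integral_of_le hab, intervalIntegral.integral_of_le hab,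
      integral_Ioc_eq_integral_Ioo, integral_Ioc_eq_integral_Ioo] at h
    linarith
  · exact hf.intervalIntegrable.mul_continuousOn hφd.continuousOn
  · exact hφd.intervalIntegrable.continuousOn_mul hf.continuousOn

end ACD

end

/-! ### From weak derivatives to absolute continuity. -/

section

theorem exists_Icc_of_isCompact_subset_Ioo {K : Set ℝ} {a b : ℝ} (hab : a < b) (hK : IsCompact K)
    (h : K ⊆ Ioo a b) : ∃ c d, a < c ∧ c ≤ d ∧ d < b ∧ K ⊆ Icc c d := by
  rcases K.eq_empty_or_nonempty with rfl | hne
  · exact ⟨(a + b) / 2, (a + b) / 2, by linarith, le_rfl, by linarith, by simp⟩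
  · obtain ⟨c, hc, hc'⟩ := hK.exists_isLeast hne
    obtain ⟨d, hd, hd'⟩ := hK.exists_isGreatest hne
    exact ⟨c, d, (h hc).1, hc' hd, (h hd).2, fun x hx => ⟨hc' hx, hd' hx⟩⟩

/-- A test function of integral zero is the derivative of a test function. -/
theorem exists_test_primitive {a b : ℝ} (hab : a < b) {g : ℝ → ℝ} (hg : ContDiff ℝ ∞ g)
    (hc : HasCompactSupport g) (hs : tsupport g ⊆ Ioo a b) (h0 : ∫ x in Ioo a b, g x = 0) :
    ∃ ψ : ℝ → ℝ, ContDiff ℝ ∞ ψ ∧ HasCompactSupport ψ ∧ tsupport ψ ⊆ Ioo a b ∧ deriv ψ = g := by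
  obtain ⟨c, d, hac, hcd, hdb, hK⟩ := exists_Icc_of_isCompact_subset_Ioo hab hc hs
  have hz : ∀ x, x ∉ Icc c d → g x = 0 := fun x hx => by
    by_contra hne
    exact hx (hK (subset_tsupport g hne))
  let ψ : ℝ → ℝ := fun x => ∫ s in a..x, g s
  have hd : ∀ x, HasDerivAt ψ (g x) x := fun x =>
    intervalIntegral.integral_hasDerivAt_right (hg.continuous.intervalIntegrable _ _)
      (hg.continuous.stronglyMeasurableAtFilter _ _) hg.continuous.continuousAt
  have hderiv : deriv ψ = g := funext fun x => (hd x).deriv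
  have hψ0 : ∀ x, x ∉ Icc c d → ψ x = 0 := by
    intro x hx
    rcases lt_or_ge x c with h | h
    · refine intervalIntegral.integral_zero_ae (.of_forall fun s hs => hz s fun hs' => ?_)
      rw [uIoc, mem_Ioc, le_max_iff] at hs
      rcases hs.2 with h2 | h2 <;> linarith [hs'.1]
    · have hdx : d < x := by
        by_contra hcon
        exact hx ⟨h, not_lt.1 hcon⟩
      -- The zero-mean hypothesis is what makes the primitive vanish again to the right of the
      -- support.
      have h1 : ∫ s in a..b, g s = 0 := by
        rw [intervalIntegral.integral_of_le hab.le, integral_Ioc_eq_integral_Ioo, h0]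
      have h2 : ∫ s in b..x, g s = 0 := by
        refine intervalIntegral.integral_zero_ae (.of_forall fun s hs => hz s fun hs' => ?_)
        rw [uIoc, mem_Ioc, min_lt_iff] at hs
        rcases hs.1 with h2 | h2 <;> linarith [hs'.2]
      have := intervalIntegral.integral_add_adjacent_intervals
        (hg.continuous.intervalIntegrable (μ := volume) a b) (hg.continuous.intervalIntegrable b x)
      simp only [ψ]
      rw [← this, h1, h2, add_zero]
  have hsupp : tsupport ψ ⊆ Icc c d := by
    refine closure_minimal (fun x hx => ?_) isClosed_Icc
    by_contra hcon
    exact hx (hψ0 x hcon)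
  refine ⟨ψ, ?_, HasCompactSupport.of_support_subset_isCompact isCompact_Icc
    ((subset_tsupport _).trans hsupp), hsupp.trans (Icc_subset_Ioo hac hdb), hderiv⟩
  rw [contDiff_infty_iff_deriv]
  exact ⟨fun x => (hd x).differentiableAt, hderiv ▸ hg⟩

/-- **Du Bois-Reymond lemma**: a continuous function with vanishing weak derivative is constant. -/
theorem exists_const_of_integral_mul_deriv_eq_zero {a b : ℝ} (hab : a < b) {w : ℝ → ℝ}
    (hw : ContinuousOn w (Icc a b))
    (h : ∀ φ : ℝ → ℝ, ContDiff ℝ ∞ φ → HasCompactSupport φ → tsupport φ ⊆ Ioo a b →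
      ∫ t in Ioo a b, w t * deriv φ t = 0) :
    ∃ k, ∀ t ∈ Icc a b, w t = k := by
  -- A fixed bump of integral 1: subtracting `c * r` from a test function of integral `c` makes it a
  -- derivative of a test function. The constant value of `w` must then be its mean against `r`.
  let ρ : ContDiffBump ((a + b) / 2) := ⟨(b - a) / 8, (b - a) / 4, by linarith, by linarith⟩
  set r := ρ.normed volume with hr
  have hrc : ContDiff ℝ ∞ r := ρ.contDiff_normed
  have hrs : tsupport r ⊆ Ioo a b := by
    rw [hr, ρ.tsupport_normed_eq, Real.closedBall_eq_Icc]
    change Icc ((a + b) / 2 - (b - a) / 4) ((a + b) / 2 + (b - a) / 4) ⊆ _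
    exact Icc_subset_Ioo (by linarith) (by linarith)
  have hrcs : HasCompactSupport r := ρ.hasCompactSupport_normed
  have hset : ∀ F : ℝ → ℝ, tsupport F ⊆ Ioo a b → ∫ t in Ioo a b, F t = ∫ t, F t := fun F hF =>
    setIntegral_eq_integral_of_forall_compl_eq_zero fun x hx => by
      by_contra hne
      exact hx (hF (subset_tsupport F hne))
  have hr1 : ∫ t in Ioo a b, r t = 1 := by rw [hset r hrs, hr, ρ.integral_normed]
  have hint : ∀ g : ℝ → ℝ, Continuous g → IntegrableOn (fun t => w t * g t) (Ioo a b) :=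
    fun g hg => ((hw.mul hg.continuousOn).integrableOn_compact isCompact_Icc).mono_set
      Ioo_subset_Icc_self
  have hintg : ∀ g : ℝ → ℝ, Continuous g → IntegrableOn g (Ioo a b) :=
    fun g hg => (hg.continuousOn.integrableOn_compact isCompact_Icc).mono_set Ioo_subset_Icc_self
  set k := ∫ t in Ioo a b, w t * r t with hk
  have hae : ∀ᵐ x, x ∈ Ioo a b → w x - k = 0 := by
    refine isOpen_Ioo.ae_eq_zero_of_integral_contDiff_smul_eq_zero ?_ fun g hg hgc hgs => ?_
    · exact ((hw.sub continuousOn_const).mono Ioo_subset_Icc_self).locallyIntegrableOn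
        measurableSet_Ioo
    · set c := ∫ t in Ioo a b, g t with hc
      have hsub : tsupport (fun t => g t - c * r t) ⊆ tsupport g ∪ tsupport r := by
        refine closure_minimal (fun x hx => ?_) ((isClosed_tsupport g).union (isClosed_tsupport r))
        by_contra hcon
        rw [mem_union, not_or] at hcon
        refine hx ?_
        simp only [image_eq_zero_of_notMem_tsupport hcon.1,
          image_eq_zero_of_notMem_tsupport hcon.2, mul_zero, sub_zero]
      obtain ⟨ψ, h1, h2, h3, h4⟩ := exists_test_primitive hab
        (g := fun t => g t - c * r t) (hg.sub (contDiff_const.mul hrc))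
        (IsCompact.of_isClosed_subset (hgc.isCompact.union hrcs.isCompact)
          (isClosed_tsupport _) hsub) (hsub.trans (union_subset hgs hrs)) (by
          rw [integral_sub (hintg g hg.continuous) ((hintg r hrc.continuous).const_mul c),
            integral_const_mul, hr1, ← hc]; ring)
      have h5 := h ψ h1 h2 h3
      rw [h4] at h5
      have h6 : ∫ t in Ioo a b, w t * (g t - c * r t) =
          (∫ t in Ioo a b, w t * g t) - c * k := by
        rw [hk, ← integral_const_mul, ← integral_sub (hint g hg.continuous)
          ((hint r hrc.continuous).const_mul c)]
        congr 1; ext t; ring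
      rw [h6] at h5
      have hts : tsupport (fun x => g x • (w x - k)) ⊆ Ioo a b :=
        (tsupport_smul_subset_left g _).trans hgs
      rw [← hset _ hts]
      have h7 : ∫ t in Ioo a b, g t • (w t - k) =
          (∫ t in Ioo a b, w t * g t) - c * k := by
        rw [hc, ← integral_mul_const, ← integral_sub (hint g hg.continuous)
          ((hintg g hg.continuous).mul_const k)]
        congr 1; ext t; simp only [smul_eq_mul]; ring
      rw [h7, h5]
  refine ⟨k, ?_⟩
  have hEq : EqOn w (fun _ => k) (Ioo a b) := by
    refine MeasureTheory.Measure.eqOn_open_of_ae_eq (μ := volume) ?_ isOpen_Ioo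
      (hw.mono Ioo_subset_Icc_self) continuousOn_const
    rw [Filter.EventuallyEq, ae_restrict_iff' measurableSet_Ioo]
    filter_upwards [hae] with x hx hm using sub_eq_zero.1 (hx hm)
  have := hEq.of_subset_closure hw continuousOn_const Ioo_subset_Icc_self
    (by rw [closure_Ioo hab.ne])
  exact fun t ht => this ht

/-- The difference of `f` and the primitive of `f'` has zero weak derivative, hence is constant. -/
theorem ACD.of_weak {f f' : ℝ → ℝ} {a b : ℝ} (hab : a ≤ b) (hf : ContinuousOn f (Icc a b))
    (hf' : IntegrableOn f' (Ioo a b))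
    (h : ∀ φ : ℝ → ℝ, ContDiff ℝ ∞ φ → HasCompactSupport φ → tsupport φ ⊆ Ioo a b →
      ∫ t in Ioo a b, f t * deriv φ t = -∫ t in Ioo a b, f' t * φ t) :
    ACD f f' a b := by
  have hI : IntervalIntegrable f' volume a b := by
    rwa [intervalIntegrable_iff_integrableOn_Ioo_of_le hab]
  refine .of_primitive hI ?_
  rcases hab.eq_or_lt with rfl | hlt
  · intro t ht
    simp only [uIcc_self, mem_singleton_iff] at ht
    simp [ht]
  have hP : ACD (fun t => ∫ s in a..t, f' s) f' a b := .of_primitive hI (by simp)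
  have hPc := hP.continuousOn
  rw [uIcc_of_le hab] at hPc ⊢
  obtain ⟨k, hk⟩ := exists_const_of_integral_mul_deriv_eq_zero hlt
    (w := fun t => f t - ∫ s in a..t, f' s) (hf.sub hPc) (fun φ h1 h2 h3 => by
      have hc : Continuous (deriv φ) := h1.continuous_deriv (by simp)
      have e1 := h φ h1 h2 h3
      have e2 := hP.integral_mul_test hab h1 h3
      simp only [sub_mul]
      rw [integral_sub, e1, e2, sub_self]
      · exact ((hf.mul hc.continuousOn).integrableOn_compact isCompact_Icc).mono_set
          Ioo_subset_Icc_self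
      · exact ((hPc.mul hc.continuousOn).integrableOn_compact isCompact_Icc).mono_set
          Ioo_subset_Icc_self)
  intro t ht
  have h1 := hk t ht
  have h2 := hk a ⟨le_rfl, hab⟩
  simp only [intervalIntegral.integral_same, sub_zero] at h2
  linarith

end

/-! ### Time intervals, and admissible curves as absolutely continuous curves. -/

section

/-- The time intervals `[0, T₀]` and `[0, ∞)`. -/
def IsTimeInterval (T : Set ℝ) : Prop := (∃ T₀ : ℝ, 0 ≤ T₀ ∧ T = Set.Icc 0 T₀) ∨ T = Set.Ici 0

namespace IsTimeInterval

variable {T : Set ℝ}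

theorem zero_mem (hT : IsTimeInterval T) : (0 : ℝ) ∈ T := by
  rcases hT with ⟨T₀, h, rfl⟩ | rfl <;> simp [*]

theorem nonneg (hT : IsTimeInterval T) {t : ℝ} (ht : t ∈ T) : 0 ≤ t := by
  rcases hT with ⟨T₀, h, rfl⟩ | rfl
  · exact ht.1
  · exact ht

theorem Icc_subset (hT : IsTimeInterval T) {a b : ℝ} (ha : a ∈ T) (hb : b ∈ T) :
    Icc a b ⊆ T := by
  rcases hT with ⟨T₀, h, rfl⟩ | rfl
  · exact Set.Icc_subset_Icc ha.1 hb.2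
  · exact fun x hx => le_trans (mem_Ici.1 ha) hx.1

theorem measurableSet (hT : IsTimeInterval T) : MeasurableSet T := by
  rcases hT with ⟨T₀, h, rfl⟩ | rfl
  · exact measurableSet_Icc
  · exact measurableSet_Ici

theorem ae_iff (hT : IsTimeInterval T) {p : ℝ → Prop} :
    (∀ᵐ t ∂(volume.restrict T), p t) ↔ ∀ᵐ t, t ∈ T → p t :=
  ae_restrict_iff' hT.measurableSet

theorem ae_mem_nhds (hT : IsTimeInterval T) : ∀ᵐ t, t ∈ T → T ∈ 𝓝 t := by
  rcases hT with ⟨T₀, h, rfl⟩ | rfl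
  · filter_upwards [ae_ne_real 0, ae_ne_real T₀] with t h1 h2 ht
    exact Icc_mem_nhds (lt_of_le_of_ne ht.1 (Ne.symm h1)) (lt_of_le_of_ne ht.2 h2)
  · filter_upwards [ae_ne_real 0] with t h1 ht
    exact Ici_mem_nhds (lt_of_le_of_ne ht (Ne.symm h1))

theorem ae_of_forall_Icc (hT : IsTimeInterval T) {p : ℝ → Prop}
    (h : ∀ b ∈ T, ∀ᵐ t, t ∈ Icc 0 b → p t) : ∀ᵐ t, t ∈ T → p t := by
  rcases hT with ⟨T₀, h0, rfl⟩ | rfl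
  · exact h T₀ ⟨h0, le_rfl⟩
  -- The half-line is a countable union of the intervals `[0, n]`, so the null sets add up to a null
  -- set.
  · have := ae_all_iff.2 fun n : ℕ => h n (mem_Ici.2 n.cast_nonneg)
    filter_upwards [this] with t ht hm
    obtain ⟨n, hn⟩ := exists_nat_ge t
    exact ht n ⟨hm, hn⟩

theorem continuousOn_of_forall_Icc (hT : IsTimeInterval T) {X : Type*} [TopologicalSpace X]
    {f : ℝ → X} (h : ∀ b ∈ T, ContinuousOn f (Icc 0 b)) : ContinuousOn f T := by
  rcases hT with ⟨T₀, h0, rfl⟩ | rfl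
  · exact h T₀ ⟨h0, le_rfl⟩
  · intro t ht
    have h1 := h (t + 1) (mem_Ici.2 (by linarith [mem_Ici.1 ht])) t ⟨ht, by linarith⟩
    refine h1.mono_of_mem_nhdsWithin ?_
    filter_upwards [self_mem_nhdsWithin, mem_nhdsWithin_of_mem_nhds
      (Iio_mem_nhds (show t < t + 1 by linarith))] with s hs1 hs2 using ⟨hs1, le_of_lt hs2⟩

end IsTimeInterval

section Graph

variable {V : Type*} [Fintype V] (G : WGraph V)

theorem WGraph.deg_pos [Nontrivial V] (i : V) : 0 < G.deg i := by
  obtain ⟨j, hj⟩ : ∃ j, G.graph.Adj i j := by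
    have := G.connected.preconnected
    exact this.exists_adj_of_nontrivial i
  exact ((G.pos_iff i j).2 hj).trans_le
    (Finset.single_le_sum (f := G.wt i) (fun k _ => G.nonneg i k) (Finset.mem_univ j))

theorem WGraph.deg_rpow_pos [Nontrivial V] (i : V) (r : ℝ) : 0 < G.deg i ^ r :=
  Real.rpow_pos_of_pos (G.deg_pos i) r

variable {G} {r : ℝ} {T : Set ℝ} {u u' v v' : ℝ → V → ℝ}

theorem IsTrajectory.acd [Nontrivial V] (hT : IsTimeInterval T) (hu : IsTrajectory G r T u u')
    {a b : ℝ} (ha : a ∈ T) (hb : b ∈ T) (hab : a ≤ b) (i : V) :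
    ACD (fun t => u t i) (fun t => u' t i) a b := by
  classical
  obtain ⟨-, hc, hw⟩ := hu
  obtain ⟨h1, h2, h3⟩ := hw a ha b hb
  have hci : ContinuousOn (fun t => u t i) (Icc a b) :=
    ((continuous_apply i).comp_continuousOn hc).mono (hT.Icc_subset ha hb)
  refine .of_weak hab hci ((h2.eval i).integrable (by norm_num)) fun φ hφ hφc hφs => ?_
  have hd := (G.deg_rpow_pos i r).ne'
  have hzero : ∀ t, t ∉ tsupport φ → φ t = 0 := fun t => image_eq_zero_of_notMem_tsupport
  -- A test function living at the single vertex `i`; the factor cancels the weight `d_i ^ r` of the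
  -- inner product.
  let Φ : ℝ → V → ℝ := fun t j => if j = i then (G.deg i ^ r)⁻¹ * φ t else 0
  have hΦ : ContDiff ℝ ∞ Φ := by
    rw [contDiff_pi]
    intro j
    by_cases hj : j = i
    · simp only [Φ, hj, if_true]
      exact contDiff_const.mul hφ
    · simp only [Φ, hj, if_false]
      exact contDiff_const
  have hΦs : Function.support Φ ⊆ tsupport φ := by
    intro t ht
    by_contra hcon
    refine ht (funext fun j => ?_)
    simp [Φ, hzero t hcon]
  have hΦd : ∀ t, deriv Φ t = fun j => if j = i then (G.deg i ^ r)⁻¹ * deriv φ t else 0 := by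
    intro t
    refine HasDerivAt.deriv (hasDerivAt_pi.2 fun j => ?_)
    by_cases hj : j = i
    · simp only [Φ, hj, if_true]
      exact ((hφ.differentiable (by simp) t).hasDerivAt).const_mul _
    · simp only [Φ, hj, if_false]
      exact hasDerivAt_const _ _
  have h4 := h3 Φ hΦ (HasCompactSupport.of_support_subset_isCompact hφc.isCompact hΦs)
    ((closure_minimal hΦs (isClosed_tsupport φ)).trans hφs)
  have e : ∀ (x : V → ℝ) (y : ℝ),
      ipV G r x (fun j => if j = i then (G.deg i ^ r)⁻¹ * y else 0) = x i * y := by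
    intro x y
    rw [ipV, Finset.sum_eq_single i]
    · rw [if_pos rfl]; field_simp
    · intro j _ hj; simp [hj]
    · simp
  simpa only [hΦd, Φ, e] using h4

/-- Bounded absolutely continuous curves in the unit box are trajectories. -/
theorem IsTrajectory.of_acd (hT : IsTimeInterval T) (hbox : ∀ t ∈ T, u t ∈ unitBox V)
    (h : ∀ b ∈ T, ∀ i, ACD (fun t => u t i) (fun t => u' t i) 0 b)
    {C : ℝ} (hC : ∀ᵐ t, t ∈ T → ∀ i, |u' t i| ≤ C) : IsTrajectory G r T u u' := by
  have hcont : ContinuousOn u T := by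
    refine hT.continuousOn_of_forall_Icc fun b hb => ?_
    rw [continuousOn_pi]
    intro i
    have := (h b hb i).continuousOn
    rwa [uIcc_of_le (hT.nonneg hb)] at this
  refine ⟨hbox, hcont, fun a ha b hb => ?_⟩
  rcases le_or_gt b a with hba | hab
  · have : Ioo a b = ∅ := Ioo_eq_empty (not_lt.2 hba)
    simp [HasWeakDerivOn, this]
  have hsub : Icc a b ⊆ T := hT.Icc_subset ha hb
  have hA : ∀ i, ACD (fun t => u t i) (fun t => u' t i) a b := fun i =>
    (h b hb i).mono (by
      rw [uIcc_of_le hab.le, uIcc_of_le (hT.nonneg hb)]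
      exact Icc_subset_Icc (hT.nonneg ha) le_rfl)
  have hAc : ∀ i, ContinuousOn (fun t => u t i) (Icc a b) := fun i => by
    simpa [uIcc_of_le hab.le] using (hA i).continuousOn
  have hAi : ∀ i, IntegrableOn (fun t => u' t i) (Ioo a b) := fun i =>
    (intervalIntegrable_iff_integrableOn_Ioo_of_le hab.le).1 (hA i).intervalIntegrable
  refine ⟨?_, ?_, fun φ hφ hφc hφs => ?_⟩
  · refine MemLp.of_eval fun i => MemLp.of_bound
      (((hAc i).mono Ioo_subset_Icc_self).aestronglyMeasurable measurableSet_Ioo) 1 ?_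
    rw [ae_restrict_iff' measurableSet_Ioo]
    refine .of_forall fun t ht => ?_
    have := hbox t (hsub (Ioo_subset_Icc_self ht)) i
    rw [Real.norm_eq_abs, abs_le]
    exact ⟨by linarith [this.1], this.2⟩
  · refine MemLp.of_eval fun i => MemLp.of_bound (hAi i).aestronglyMeasurable C ?_
    rw [ae_restrict_iff' measurableSet_Ioo]
    filter_upwards [hC] with t ht hm using ht (hsub (Ioo_subset_Icc_self hm)) i
  · have hφi : ∀ i, ContDiff ℝ ∞ (fun t => φ t i) := fun i => contDiff_pi.1 hφ i
    have hφis : ∀ i, tsupport (fun t => φ t i) ⊆ Ioo a b := fun i =>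
      (closure_mono (show Function.support (fun t => φ t i) ⊆ Function.support φ from
        fun t ht h0 => ht (by simp [h0]))).trans hφs
    have hder : ∀ t i, deriv φ t i = deriv (fun s => φ s i) t := fun t i => by
      rw [deriv_pi fun j => (hφi j).differentiable (by simp) t]
    have hφc' : ∀ i, ContinuousOn (fun t => φ t i) (Icc a b) := fun i =>
      (hφi i).continuous.continuousOn
    have hφd' : ∀ i, ContinuousOn (deriv fun t => φ t i) (Icc a b) := fun i =>
      ((hφi i).continuous_deriv (by simp)).continuousOn
    simp only [ipV, hder]
    rw [integral_finsetSum, integral_finsetSum, ← Finset.sum_neg_distrib]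
    · refine Finset.sum_congr rfl fun i _ => ?_
      rw [integral_mul_const, integral_mul_const,
        (hA i).integral_mul_test hab.le (hφi i) (hφis i), neg_mul]
    · intro i _
      refine Integrable.mul_const ?_ _
      exact ((hA i).intervalIntegrable.mul_continuousOn
        (by rw [uIcc_of_le hab.le]; exact hφc' i)).1.mono_set Ioo_subset_Ioc_self
    · intro i _
      refine Integrable.mul_const ?_ _
      exact (((hAc i).mul (hφd' i)).integrableOn_compact isCompact_Icc).mono_set
        Ioo_subset_Icc_self

theorem IsTrajectory.ae_hasDerivAt [Nontrivial V] (hT : IsTimeInterval T)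
    (hu : IsTrajectory G r T u u') :
    ∀ᵐ t, t ∈ T → ∀ i, HasDerivAt (fun s => u s i) (u' t i) t := by
  refine hT.ae_of_forall_Icc fun b hb => ?_
  have := ae_all_iff.2 fun i => (hu.acd hT hT.zero_mem hb (hT.nonneg hb) i).2
  filter_upwards [this] with t ht hm i
  exact ht i (by rwa [uIcc_of_le (hT.nonneg hb)])

theorem IsTrajectory.ae_deriv_eq [Nontrivial V] (hT : IsTimeInterval T)
    (hu : IsTrajectory G r T u u') (hv : IsTrajectory G r T v v') (h : ∀ t ∈ T, u t = v t) :
    ∀ᵐ t, t ∈ T → u' t = v' t := by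
  -- The curves agree on `T` only, so derivatives are compared at points having `T` as a
  -- neighbourhood, that is, almost everywhere.
  filter_upwards [hu.ae_hasDerivAt hT, hv.ae_hasDerivAt hT, hT.ae_mem_nhds] with t h1 h2 h3 hm
  ext i
  refine (h1 hm i).unique ((h2 hm i).congr_of_eventuallyEq ?_)
  filter_upwards [h3 hm] with s hs
  rw [h s hs]

/-- The derivative of a coordinate vanishes a.e. where the coordinate touches the obstacles. -/
theorem IsTrajectory.ae_deriv_eq_zero [Nontrivial V] (hT : IsTimeInterval T)
    (hu : IsTrajectory G r T u u') :
    ∀ᵐ t, t ∈ T → ∀ i, u t i = 0 ∨ u t i = 1 → u' t i = 0 := by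
  filter_upwards [hu.ae_hasDerivAt hT, hT.ae_mem_nhds] with t h1 h3 hm i hi
  rcases hi with hi | hi
  -- The box constraint makes a coordinate equal to 0 minimal over `T`, and `t` is interior to `T`.
  · refine IsLocalMin.hasDerivAt_eq_zero (f := fun s => u s i) ?_ (h1 hm i)
    filter_upwards [h3 hm] with s hs
    rw [hi]; exact (hu.1 s hs i).1
  · refine IsLocalMax.hasDerivAt_eq_zero (f := fun s => u s i) ?_ (h1 hm i)
    filter_upwards [h3 hm] with s hs
    rw [hi]; exact (hu.1 s hs i).2

end Graph

end

/-! ### Comparison, energy decay, multiplier bounds and the weak form. -/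

section

variable {V : Type*} [Fintype V] {G : WGraph V} {r ε : ℝ} {μ ft : V → ℝ}

/-- Discrete Green formula: exchange the two summation indices, use the symmetry of the weights, and
average. -/
theorem WGraph.sum_mul_sum_wt (G : WGraph V) (x y : V → ℝ) :
    ∑ i, x i * ∑ j, G.wt i j * (y i - y j) =
      1 / 2 * ∑ i, ∑ j, G.wt i j * ((x i - x j) * (y i - y j)) := by
  have h1 : ∑ i, ∑ j, G.wt i j * (x j * (y i - y j)) =
      -∑ i, ∑ j, G.wt i j * (x i * (y i - y j)) := by
    rw [Finset.sum_comm, ← Finset.sum_neg_distrib]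
    refine Finset.sum_congr rfl fun i _ => ?_
    rw [← Finset.sum_neg_distrib]
    refine Finset.sum_congr rfl fun j _ => ?_
    rw [G.symm j i]; ring
  have h2 : ∑ i, ∑ j, G.wt i j * ((x i - x j) * (y i - y j)) =
      ∑ i, ∑ j, G.wt i j * (x i * (y i - y j)) - ∑ i, ∑ j, G.wt i j * (x j * (y i - y j)) := by
    simp only [← Finset.sum_sub_distrib]
    refine Finset.sum_congr rfl fun i _ => Finset.sum_congr rfl fun j _ => ?_
    ring
  rw [h2, h1, sub_neg_eq_add, ← two_mul, ← mul_assoc]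
  norm_num
  refine Finset.sum_congr rfl fun i _ => ?_
  rw [Finset.mul_sum]
  refine Finset.sum_congr rfl fun j _ => ?_
  ring

theorem mem_setB_iff {V : Type*} {u α : V → ℝ} :
    α ∈ setB u ↔ ∀ i, u i ∈ Icc (0 : ℝ) 1 ∧ (u i < 1 → 0 ≤ α i) ∧ (0 < u i → α i ≤ 0) :=
  forall_congr' fun _ => neg_mem_subdiff_indI

/-- The box is a product, so its normal cone is found by varying one coordinate of `u` at a time;
the weights are positive and do not affect signs. -/
theorem mem_setB_iff_ipV [Nontrivial V] {u α : V → ℝ} (hu : u ∈ unitBox V) :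
    α ∈ setB u ↔ ∀ η ∈ unitBox V, 0 ≤ ipV G r α (η - u) := by
  classical
  rw [mem_setB_iff]
  constructor
  · intro h η hη
    refine Finset.sum_nonneg fun i _ => mul_nonneg ?_ (G.deg_rpow_pos i r).le
    obtain ⟨-, h1, h2⟩ := h i
    rw [Pi.sub_apply]
    rcases lt_trichotomy (η i) (u i) with h3 | h3 | h3
    · have := h2 ((hη i).1.trans_lt h3)
      nlinarith
    · simp [h3]
    · have := h1 (h3.trans_le (hη i).2)
      nlinarith
  · intro h i
    have key : ∀ x ∈ Icc (0 : ℝ) 1, 0 ≤ α i * (x - u i) := by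
      intro x hx
      have h1 := h (Function.update u i x) (fun j => by
        by_cases hj : j = i
        · subst hj; simpa using hx
        · simpa [hj] using hu j)
      rw [ipV, Finset.sum_eq_single i] at h1
      · simp only [Pi.sub_apply, Function.update_self] at h1
        exact nonneg_of_mul_nonneg_left h1 (G.deg_rpow_pos i r)
      · intro j _ hj
        simp [hj]
      · simp
    refine ⟨hu i, fun h1 => ?_, fun h0 => ?_⟩
    · have := key 1 (by simp)
      exact nonneg_of_mul_nonneg_left this (by linarith)
    · have := key 0 (by simp)
      nlinarith

theorem normV_le_of_abs_le [Nontrivial V] {x : V → ℝ} {C : ℝ} (hC : 0 ≤ C)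
    (h : ∀ i, |x i| ≤ C) : normV G r x ≤ √(∑ i, G.deg i ^ r) * C := by
  have : ipV G r x x ≤ (∑ i, G.deg i ^ r) * C ^ 2 := by
    rw [ipV, Finset.sum_mul]
    refine Finset.sum_le_sum fun i _ => ?_
    rw [mul_comm]
    refine mul_le_mul_of_nonneg_left ?_ (G.deg_rpow_pos i r).le
    rw [← sq, ← sq_abs]
    exact pow_le_pow_left₀ (abs_nonneg _) (h i) 2
  refine (Real.sqrt_le_sqrt this).trans ?_
  rw [Real.sqrt_mul' _ (sq_nonneg C), Real.sqrt_sq hC]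

variable [DecidableEq V]

theorem opA_mulVec (u : V → ℝ) (i : V) :
    (opA G r μ *ᵥ u) i =
      G.deg i ^ (-r) * ∑ j, G.wt i j * (u i - u j) + μ i * u i := by
  rw [opA, Matrix.add_mulVec, Pi.add_apply, lap_mulVec, fidM, Matrix.mulVec_diagonal]

theorem fidf_apply (i : V) : fidf μ ft i = μ i * ft i := by
  rw [fidf, fidM, Matrix.mulVec_diagonal]

theorem aceLHS_apply (u u' : V → ℝ) (i : V) :
    aceLHS G r ε μ ft u u' i =
      ε * u' i + ε * (G.deg i ^ (-r) * ∑ j, G.wt i j * (u i - u j) + μ i * u i)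
        - ε * (μ i * ft i) + 1 / 2 - u i := by
  simp [aceLHS, opA_mulVec, fidf_apply]

/-- Multiplying by `d_i ^ r` clears the `d_i ^ (-r)` of the Laplacian and leaves the symmetric
weights required by Green's formula. -/
theorem deg_rpow_mul_aceLHS [Nontrivial V] (u u' : V → ℝ) (i : V) :
    G.deg i ^ r * aceLHS G r ε μ ft u u' i =
      ε * ∑ j, G.wt i j * (u i - u j) +
        G.deg i ^ r * (ε * u' i + ε * μ i * (u i - ft i) + 1 / 2 - u i) := by
  have h : G.deg i ^ r * G.deg i ^ (-r) = 1 := by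
    rw [← Real.rpow_add (G.deg_pos i), add_neg_cancel, Real.rpow_zero]
  rw [aceLHS_apply]
  linear_combination (ε * ∑ j, G.wt i j * (u i - u j)) * h

/-- The differential inequality behind the comparison principle. -/
theorem sum_posPart_mul_deriv_le [Nontrivial V] (hε : 0 < ε) (hμ : ∀ i, 0 ≤ μ i)
    {u u' β v v' γ : V → ℝ} (hu : β ≤ aceLHS G r ε μ ft u u') (hβ : β ∈ setB u)
    (hv : aceLHS G r ε μ ft v v' ≤ γ) (hγ : γ ∈ setB v) :
    ∑ i, G.deg i ^ r * (2 * max (v i - u i) 0 * (v' i - u' i)) ≤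
      2 / ε * ∑ i, G.deg i ^ r * max (v i - u i) 0 ^ 2 := by
  rw [mem_setB_iff] at hβ hγ
  set w : V → ℝ := fun i => v i - u i with hw
  set p : V → ℝ := fun i => max (v i - u i) 0 with hp
  -- Since `x ↦ max x 0` is monotone, every product in Green's formula is nonnegative.
  have hlap : 0 ≤ ∑ i, p i * ∑ j, G.wt i j * (w i - w j) := by
    rw [G.sum_mul_sum_wt]
    refine mul_nonneg (by norm_num) (Finset.sum_nonneg fun i _ => Finset.sum_nonneg fun j _ =>
      mul_nonneg (G.nonneg i j) ?_)
    change 0 ≤ (max (w i) 0 - max (w j) 0) * (w i - w j)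
    rcases le_total (w i) (w j) with h | h
    · exact mul_nonneg_of_nonpos_of_nonpos (sub_nonpos.2 (max_le_max_right 0 h)) (by linarith)
    · exact mul_nonneg (sub_nonneg.2 (max_le_max_right 0 h)) (by linarith)
  have hi : ∀ i, G.deg i ^ r * (p i * (ε * (v' i - u' i))) ≤
      G.deg i ^ r * p i ^ 2 - ε * (p i * ∑ j, G.wt i j * (w i - w j)) := by
    intro i
    have hd := G.deg_rpow_pos i r
    rcases le_or_gt (v i - u i) 0 with h0 | h0
    · have : p i = 0 := max_eq_right h0
      simp [this]
    · have hpi : p i = v i - u i := max_eq_left h0.le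
      -- From `u i < v i` follow `u i < 1` and `0 < v i`, which fix the signs of both multipliers.
      have h1 : 0 ≤ β i := (hβ i).2.1 (by linarith [(hγ i).1.2])
      have h2 : γ i ≤ 0 := (hγ i).2.2 (by linarith [(hβ i).1.1])
      have h3 := mul_le_mul_of_nonneg_left ((hv i).trans (h2.trans (h1.trans (hu i)))) hd.le
      rw [deg_rpow_mul_aceLHS, deg_rpow_mul_aceLHS] at h3
      have h4 : ∑ j, G.wt i j * (w i - w j) =
          ∑ j, G.wt i j * (v i - v j) - ∑ j, G.wt i j * (u i - u j) := by
        rw [← Finset.sum_sub_distrib]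
        exact Finset.sum_congr rfl fun j _ => by simp only [hw]; ring
      have h5 : G.deg i ^ r * (ε * (v' i - u' i)) ≤
          G.deg i ^ r * p i - ε * ∑ j, G.wt i j * (w i - w j) := by
        have h6 : 0 ≤ G.deg i ^ r * (ε * μ i * (v i - u i)) :=
          mul_nonneg hd.le (mul_nonneg (mul_nonneg hε.le (hμ i)) h0.le)
        rw [h4, hpi]
        linarith
      have := mul_le_mul_of_nonneg_left h5 (show 0 ≤ p i from hpi ▸ h0.le)
      linarith
  have hsum := Finset.sum_le_sum fun i (_ : i ∈ Finset.univ) => hi i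
  rw [Finset.sum_sub_distrib, ← Finset.mul_sum] at hsum
  have e1 : ∑ i, G.deg i ^ r * (2 * max (v i - u i) 0 * (v' i - u' i)) =
      2 / ε * ∑ i, G.deg i ^ r * (p i * (ε * (v' i - u' i))) := by
    rw [Finset.mul_sum]
    refine Finset.sum_congr rfl fun i _ => ?_
    simp only [hp]
    field_simp
  rw [e1]
  refine mul_le_mul_of_nonneg_left ?_ (by positivity)
  linarith [mul_nonneg hε.le hlap]

/-- Gronwall's inequality for absolutely continuous functions. -/
theorem ACD.le_exp_mul {f f' : ℝ → ℝ} {a b c : ℝ} (hf : ACD f f' a b) (hab : a ≤ b)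
    (h : ∀ᵐ t, t ∈ Icc a b → f' t ≤ c * f t) : f b ≤ Real.exp (c * (b - a)) * f a := by
  have hE : ACD (fun t => Real.exp (-(c * t))) (fun t => Real.exp (-(c * t)) * -(c * 1)) a b :=
    .of_contDiff (by fun_prop) fun t => (((hasDerivAt_id t).const_mul c).neg).exp
  have h1 := (hE.mul hf).le_of_deriv_nonpos hab (by
    filter_upwards [h] with t ht hm
    nlinarith [ht hm, Real.exp_pos (-(c * t))])
  have e : Real.exp (c * b) * Real.exp (-(c * b)) = 1 := by
    rw [← Real.exp_add]; simp
  calc f b = Real.exp (c * b) * (Real.exp (-(c * b)) * f b) := by rw [← mul_assoc, e, one_mul]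
    _ ≤ Real.exp (c * b) * (Real.exp (-(c * a)) * f a) :=
      mul_le_mul_of_nonneg_left h1 (Real.exp_pos _).le
    _ = Real.exp (c * (b - a)) * f a := by
      rw [← mul_assoc, ← Real.exp_add]; ring_nf

variable {T : Set ℝ} {u u' v v' β γ : ℝ → V → ℝ}

theorem IsTrajectory.comparison [Nontrivial V] (hT : IsTimeInterval T) (hε : 0 < ε)
    (hμ : ∀ i, 0 ≤ μ i) (hu : IsTrajectory G r T u u') (hv : IsTrajectory G r T v v')
    (hβ : ∀ᵐ t, t ∈ T → β t ≤ aceLHS G r ε μ ft (u t) (u' t) ∧ β t ∈ setB (u t))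
    (hγ : ∀ᵐ t, t ∈ T → aceLHS G r ε μ ft (v t) (v' t) ≤ γ t ∧ γ t ∈ setB (v t))
    (h0 : v 0 ≤ u 0) {t : ℝ} (ht : t ∈ T) : v t ≤ u t := by
  have h0t := hT.nonneg ht
  have hA : ACD (fun s => ∑ i, G.deg i ^ r * max (v s i - u s i) 0 ^ 2)
      (fun s => ∑ i, G.deg i ^ r * (2 * max (v s i - u s i) 0 * (v' s i - u' s i))) 0 t :=
    ACD.sum _ fun i _ => ((((hv.acd hT hT.zero_mem ht h0t i).sub
      (hu.acd hT hT.zero_mem ht h0t i)).posPart_sq).const_mul _)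
  have h1 := hA.le_exp_mul (c := 2 / ε) h0t (by
    filter_upwards [hβ, hγ] with s hs1 hs2 hm
    have hsT := hT.Icc_subset hT.zero_mem ht hm
    exact sum_posPart_mul_deriv_le hε hμ (hs1 hsT).1 (hs1 hsT).2 (hs2 hsT).1 (hs2 hsT).2)
  have h2 : ∑ i, G.deg i ^ r * max (v 0 i - u 0 i) 0 ^ 2 = 0 :=
    Finset.sum_eq_zero fun i _ => by rw [max_eq_right (by linarith [h0 i])]; simp
  rw [h2, mul_zero] at h1
  have hnn : ∀ i ∈ Finset.univ, 0 ≤ G.deg i ^ r * max (v t i - u t i) 0 ^ 2 := fun i _ =>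
    mul_nonneg (G.deg_rpow_pos i r).le (by positivity)
  have h3 := (Finset.sum_eq_zero_iff_of_nonneg hnn).1 (le_antisymm h1 (Finset.sum_nonneg hnn))
  intro i
  have h4 := h3 i (Finset.mem_univ i)
  rcases mul_eq_zero.1 h4 with h5 | h5
  · exact absurd h5 (G.deg_rpow_pos i r).ne'
  · have h6 : max (v t i - u t i) 0 = 0 := by simpa using h5
    linarith [le_max_left (v t i - u t i) 0]

theorem IsSolution.unique [Nontrivial V] (hT : IsTimeInterval T) (hε : 0 < ε)
    (hμ : ∀ i, 0 ≤ μ i) (hu : IsSolution G r ε μ ft T u β) (hv : IsSolution G r ε μ ft T v γ)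
    (h0 : u 0 = v 0) : (∀ t ∈ T, u t = v t) ∧ ∀ᵐ t, t ∈ T → β t = γ t := by
  obtain ⟨u', hu, hβ⟩ := hu
  obtain ⟨v', hv, hγ⟩ := hv
  rw [hT.ae_iff] at hβ hγ
  have huv : ∀ t ∈ T, u t = v t := fun t ht => le_antisymm
    (hv.comparison hT hε hμ hu
      (hγ.mono fun s h hs => ⟨(h hs).1.ge, (h hs).2⟩)
      (hβ.mono fun s h hs => ⟨(h hs).1.le, (h hs).2⟩) h0.le ht)
    (hu.comparison hT hε hμ hv
      (hβ.mono fun s h hs => ⟨(h hs).1.ge, (h hs).2⟩)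
      (hγ.mono fun s h hs => ⟨(h hs).1.le, (h hs).2⟩) h0.ge ht)
  -- Equal curves have equal derivatives a.e., and the equation then determines the multiplier.
  refine ⟨huv, ?_⟩
  filter_upwards [hβ, hγ, hu.ae_deriv_eq hT hv huv] with t h1 h2 h3 hm
  rw [← (h1 hm).1, ← (h2 hm).1, h3 hm, huv t hm]

/-! ### Energy -/

/-- The value of the energy on the unit box. -/
def energyReal (G : WGraph V) (r ε : ℝ) (μ ft u : V → ℝ) : ℝ :=
  1 / 4 * ∑ i, ∑ j, G.wt i j * (u i - u j) ^ 2 +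
    ∑ i, G.deg i ^ r * (1 / (2 * ε) * (u i * (1 - u i)) + 1 / 2 * μ i * (u i - ft i) ^ 2)

theorem energy_eq_coe {u : V → ℝ} (hu : u ∈ unitBox V) :
    energy G r ε μ ft u = (energyReal G r ε μ ft u : EReal) := by
  have h1 : normE G (grad G u) ^ 2 = 1 / 2 * ∑ i, ∑ j, G.wt i j * (u i - u j) ^ 2 := by
    have e : ipE G (grad G u) (grad G u) = 1 / 2 * ∑ i, ∑ j, G.wt i j * (u i - u j) ^ 2 := by
      rw [ipE]
      congr 1
      refine Finset.sum_congr rfl fun i _ => Finset.sum_congr rfl fun j _ => ?_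
      rw [grad]
      split_ifs with h
      · ring
      · have : G.wt i j = 0 :=
          le_antisymm (not_lt.1 fun h' => h ((G.pos_iff i j).1 h')) (G.nonneg i j)
        simp [this]
    rw [normE, Real.sq_sqrt, e]
    rw [e]
    exact mul_nonneg (by norm_num) (Finset.sum_nonneg fun i _ => Finset.sum_nonneg fun j _ =>
      mul_nonneg (G.nonneg i j) (sq_nonneg _))
  have h2 : ∑ i, potW (u i) * ((G.deg i ^ r : ℝ) : EReal) =
      ((∑ i, 1 / 2 * u i * (1 - u i) * G.deg i ^ r : ℝ) : EReal) := by
    have h : ∀ i, potW (u i) * ((G.deg i ^ r : ℝ) : EReal) =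
        ((1 / 2 * u i * (1 - u i) * G.deg i ^ r : ℝ) : EReal) := fun i => by
      rw [potW, if_pos (hu i), ← EReal.coe_mul]
    simp only [h]
    exact (map_sum (⟨⟨Real.toEReal, EReal.coe_zero⟩, EReal.coe_add⟩ : ℝ →+ EReal) _ _).symm
  rw [energy, h1, h2, ← EReal.coe_mul, ← EReal.coe_add, ← EReal.coe_add, EReal.coe_eq_coe_iff,
    energyReal, add_assoc, ipV, Finset.mul_sum (a := (1 / ε : ℝ)),
    Finset.mul_sum (a := (1 / 2 : ℝ))
      (f := fun i => (u - ft) i * (fidM μ *ᵥ (u - ft)) i * G.deg i ^ r),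
    ← Finset.sum_add_distrib]
  congr 1
  · ring
  · refine Finset.sum_congr rfl fun i _ => ?_
    rw [fidM, Matrix.mulVec_diagonal, Pi.sub_apply]
    ring

theorem IsSolution.antitoneOn_energy [Nontrivial V] (hT : IsTimeInterval T) (hε : 0 < ε)
    (hu : IsSolution G r ε μ ft T u β) : AntitoneOn (fun t => energy G r ε μ ft (u t)) T := by
  obtain ⟨u', hu, hβ⟩ := hu
  rw [hT.ae_iff] at hβ
  intro a ha b hb hab
  simp only
  rw [energy_eq_coe (hu.1 a ha), energy_eq_coe (hu.1 b hb), EReal.coe_le_coe_iff]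
  have hA := fun i => hu.acd hT ha hb hab i
  have hE : ACD (fun t => energyReal G r ε μ ft (u t))
      (fun t => 1 / 4 * ∑ i, ∑ j, G.wt i j * (2 * (u t i - u t j) * (u' t i - u' t j)) +
        ∑ i, G.deg i ^ r *
          (1 / (2 * ε) * (u' t i * (1 - u t i) + u t i * (0 - u' t i)) +
            1 / 2 * μ i * (2 * (u t i - ft i) * (u' t i - 0)))) a b :=
    ((ACD.sum _ fun i _ => ACD.sum _ fun j _ =>
      (((hA i).sub (hA j)).sq).const_mul _).const_mul _).add
      (ACD.sum _ fun i _ => ((((hA i).mul ((ACD.const 1 a b).sub (hA i))).const_mul _).add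
        ((((hA i).sub (ACD.const (ft i) a b)).sq).const_mul _)).const_mul _)
  refine hE.le_of_deriv_nonpos hab ?_
  filter_upwards [hβ, hu.ae_deriv_eq_zero hT] with t h1 h2 hm
  have htT := hT.Icc_subset ha hb hm
  obtain ⟨h3, h4⟩ := h1 htT
  rw [mem_setB_iff] at h4
  have e1 : 1 / 4 * ∑ i, ∑ j, G.wt i j * (2 * (u t i - u t j) * (u' t i - u' t j)) =
      ∑ i, u' t i * ∑ j, G.wt i j * (u t i - u t j) := by
    rw [G.sum_mul_sum_wt, Finset.mul_sum, Finset.mul_sum]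
    refine Finset.sum_congr rfl fun i _ => ?_
    rw [Finset.mul_sum, Finset.mul_sum]
    refine Finset.sum_congr rfl fun j _ => ?_
    ring
  rw [e1, ← Finset.sum_add_distrib]
  refine Finset.sum_nonpos fun i _ => ?_
  -- Complementarity: on the obstacles the velocity vanishes, strictly between them the multiplier
  -- does.
  have h5 : u' t i * β t i = 0 := by
    by_cases h : u t i = 0 ∨ u t i = 1
    · rw [h2 htT i h, zero_mul]
    · rw [not_or] at h
      obtain ⟨h6, h7, h8⟩ := h4 i
      rw [le_antisymm (h8 (lt_of_le_of_ne h6.1 (Ne.symm h.1))) (h7 (lt_of_le_of_ne h6.2 h.2)),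
        mul_zero]
  have h6 := deg_rpow_mul_aceLHS (G := G) (r := r) (ε := ε) (μ := μ) (ft := ft) (u t) (u' t) i
  rw [h3] at h6
  have h7 : ∑ j, G.wt i j * (u t i - u t j) = G.deg i ^ r * β t i / ε -
      G.deg i ^ r * (u' t i + μ i * (u t i - ft i) + 1 / (2 * ε) - u t i / ε) := by
    field_simp
    linear_combination -2 * h6
  have h8 : u' t i * ∑ j, G.wt i j * (u t i - u t j) + G.deg i ^ r *
        (1 / (2 * ε) * (u' t i * (1 - u t i) + u t i * (0 - u' t i)) +
          1 / 2 * μ i * (2 * (u t i - ft i) * (u' t i - 0))) =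
      -(G.deg i ^ r * u' t i ^ 2) := by
    rw [h7]
    field_simp
    linear_combination (2 * G.deg i ^ r) * h5
  rw [h8]
  exact neg_nonpos.2 (mul_nonneg (G.deg_rpow_pos i r).le (sq_nonneg _))

/-! ### Bounds on the multiplier and Lipschitz regularity -/

/-- On an obstacle the velocity is zero and the equation reads off `β`. At 0 it is 1/2 plus a
nonpositive Laplacian term minus `ε μ_i f̃_i`; at 1 it is -1/2 plus nonnegative terms. The sign
conditions give the other bounds. -/
theorem IsTrajectory.ae_abs_le_half [Nontrivial V] (hT : IsTimeInterval T) (hε : 0 < ε)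
    (hμ : ∀ i, 0 ≤ μ i) (hft : ft ∈ unitBox V) (hu : IsTrajectory G r T u u')
    (hβ : ∀ᵐ t, t ∈ T → aceLHS G r ε μ ft (u t) (u' t) = β t ∧ β t ∈ setB (u t)) :
    ∀ᵐ t, t ∈ T → ∀ i, β t i ∈ Icc (-1 / 2 : ℝ) (1 / 2) := by
  filter_upwards [hβ, hu.ae_deriv_eq_zero hT] with t h1 h2 hm i
  obtain ⟨h3, h4⟩ := h1 hm
  rw [mem_setB_iff] at h4
  obtain ⟨h6, h7, h8⟩ := h4 i
  have hd : 0 < G.deg i ^ (-r) := G.deg_rpow_pos i _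
  have h9 := congrFun h3 i
  rw [aceLHS_apply] at h9
  rcases eq_or_ne (u t i) 0 with h | h
  · rw [h2 hm i (.inl h), h] at h9
    have h10 : ∑ j, G.wt i j * (0 - u t j) ≤ 0 := Finset.sum_nonpos fun j _ =>
      mul_nonpos_of_nonneg_of_nonpos (G.nonneg i j) (by linarith [(hu.1 t hm j).1])
    have h11 := mul_nonneg hε.le (mul_nonneg (hμ i) (hft i).1)
    have h12 := mul_nonpos_of_nonneg_of_nonpos (mul_nonneg hε.le hd.le) h10
    have h13 := h7 (by rw [h]; norm_num)
    exact ⟨by linarith, by linarith⟩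
  rcases eq_or_ne (u t i) 1 with h' | h'
  · rw [h2 hm i (.inr h'), h'] at h9
    have h10 : 0 ≤ ∑ j, G.wt i j * (1 - u t j) := Finset.sum_nonneg fun j _ =>
      mul_nonneg (G.nonneg i j) (by linarith [(hu.1 t hm j).2])
    have h11 := mul_nonneg hε.le (mul_nonneg (hμ i) (sub_nonneg.2 (hft i).2))
    have h12 := mul_nonneg (mul_nonneg hε.le hd.le) h10
    have h13 := h8 (by rw [h']; norm_num)
    exact ⟨by linarith, by linarith⟩
  · rw [le_antisymm (h8 (lt_of_le_of_ne h6.1 (Ne.symm h))) (h7 (lt_of_le_of_ne h6.2 h'))]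
    norm_num

theorem exists_abs_deriv_le (hε : 0 < ε) (G : WGraph V) (r : ℝ) (μ ft : V → ℝ) :
    ∃ C, ∀ u u' : V → ℝ, u ∈ unitBox V →
      (∀ i, aceLHS G r ε μ ft u u' i ∈ Icc (-1 / 2 : ℝ) (1 / 2)) → ∀ i, |u' i| ≤ C := by
  set c : V → ℝ := fun i => ε * ∑ j, |opA G r μ i j| + ε * |fidf μ ft i| with hc
  have hcn : ∀ i, 0 ≤ c i := fun i => by positivity
  -- The 2 collects 1/2 from the multiplier, 1/2 from the constant term and 1 from `u`; summing `c`
  -- makes the bound uniform in the vertex.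
  refine ⟨ε⁻¹ * (2 + ∑ i, c i), fun u u' hu h i => ?_⟩
  have h1 : |(opA G r μ *ᵥ u) i| ≤ ∑ j, |opA G r μ i j| := by
    refine (Finset.abs_sum_le_sum_abs _ _).trans (Finset.sum_le_sum fun j _ => ?_)
    rw [abs_mul, abs_of_nonneg (hu j).1]
    exact mul_le_of_le_one_right (abs_nonneg _) (hu j).2
  have h2 : c i ≤ ∑ i, c i := Finset.single_le_sum (fun i _ => hcn i) (Finset.mem_univ i)
  have h3 : ε * |u' i| ≤ 2 + c i := by
    have e : ε * u' i = aceLHS G r ε μ ft u u' i - ε * (opA G r μ *ᵥ u) i + ε * fidf μ ft i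
        - 1 / 2 + u i := by
      simp [aceLHS]; ring
    have h3 : ε * |u' i| = |ε * u' i| := by rw [abs_mul, abs_of_pos hε]
    rw [h3, e, abs_le]
    have h4 := abs_le.1 h1
    have h5 := neg_abs_le (fidf μ ft i)
    have h6 := le_abs_self (fidf μ ft i)
    have h7 := h i
    have h8 := hu i
    have h9 := mul_le_mul_of_nonneg_left h4.1 hε.le
    have h10 := mul_le_mul_of_nonneg_left h4.2 hε.le
    have h11 := mul_le_mul_of_nonneg_left h5 hε.le
    have h12 := mul_le_mul_of_nonneg_left h6 hε.le
    simp only [hc]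
    constructor <;> linarith [h7.1, h7.2, h8.1, h8.2]
  rw [inv_mul_eq_div, le_div_iff₀ hε]
  linarith

theorem IsSolution.lipschitz [Nontrivial V] (hT : IsTimeInterval T) (hε : 0 < ε)
    (hμ : ∀ i, 0 ≤ μ i) (hft : ft ∈ unitBox V) (hu : IsSolution G r ε μ ft T u β) :
    ∃ K : ℝ, ∀ s ∈ T, ∀ t ∈ T, normV G r (u t - u s) ≤ K * |t - s| := by
  obtain ⟨u', hu, hβ⟩ := hu
  rw [hT.ae_iff] at hβ
  obtain ⟨C, hC⟩ := exists_abs_deriv_le hε G r μ ft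
  have hC' : ∀ᵐ t, t ∈ T → ∀ i, |u' t i| ≤ |C| := by
    filter_upwards [hβ, hu.ae_abs_le_half hT hε hμ hft hβ] with t h1 h2 hm i
    exact (hC _ _ (hu.1 t hm) (fun j => by rw [(h1 hm).1]; exact h2 hm j) i).trans (le_abs_self C)
  have key : ∀ s ∈ T, ∀ t ∈ T, s ≤ t → ∀ i, |u t i - u s i| ≤ |C| * |t - s| := by
    intro s hs t ht hst i
    rw [← (hu.acd hT hs ht hst i).integral_eq, ← Real.norm_eq_abs]
    refine intervalIntegral.norm_integral_le_of_norm_le_const_ae ?_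
    filter_upwards [hC'] with x hx hm
    rw [uIoc_of_le hst] at hm
    exact hx (hT.Icc_subset hs ht (Ioc_subset_Icc_self hm)) i
  refine ⟨√(∑ i, G.deg i ^ r) * |C|, fun s hs t ht => ?_⟩
  rw [mul_assoc]
  refine normV_le_of_abs_le (by positivity) fun i => ?_
  rcases le_total s t with h | h
  · exact key s hs t ht h i
  · rw [abs_sub_comm t s, Pi.sub_apply, abs_sub_comm]
    exact key t ht s hs h i

/-! ### Weak form -/

theorem IsTrajectory.isSolution_iff_isWeakForm [Nontrivial V] (hT : IsTimeInterval T)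
    (hu : IsTrajectory G r T u u')
    (hβ : ∀ᵐ t, t ∈ T → β t = aceLHS G r ε μ ft (u t) (u' t)) :
    IsSolution G r ε μ ft T u β ↔ IsWeakForm G r ε μ ft T u u' := by
  constructor
  · rintro ⟨v', hv, h⟩
    rw [hT.ae_iff] at h
    rw [IsWeakForm, hT.ae_iff]
    -- `IsSolution` supplies its own weak derivative, which agrees a.e. with the given one.
    filter_upwards [h, hv.ae_deriv_eq hT hu fun _ _ => rfl] with t h1 h2 hm
    rw [← h2 hm, (h1 hm).1]
    exact (mem_setB_iff_ipV (hu.1 t hm)).1 (h1 hm).2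
  · intro h
    rw [IsWeakForm, hT.ae_iff] at h
    refine ⟨u', hu, hT.ae_iff.2 ?_⟩
    filter_upwards [h, hβ] with t h1 h2 hm
    refine ⟨(h2 hm).symm, (mem_setB_iff_ipV (G := G) (r := r) (hu.1 t hm)).2 ?_⟩
    rw [h2 hm]
    exact h1 hm

theorem IsTrajectory.exists_isSolution_iff_isWeakForm [Nontrivial V] (hT : IsTimeInterval T)
    (hu : IsTrajectory G r T u u') :
    (∃ β, IsSolution G r ε μ ft T u β) ↔ IsWeakForm G r ε μ ft T u u' := by
  constructor
  · rintro ⟨β, hβ⟩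
    have hs := hβ
    obtain ⟨v', hv, h⟩ := hβ
    rw [hT.ae_iff] at h
    refine (hu.isSolution_iff_isWeakForm hT ?_).1 hs
    filter_upwards [h, hv.ae_deriv_eq hT hu fun _ _ => rfl] with t h1 h2 hm
    rw [← h2 hm, (h1 hm).1]
  · intro h
    exact ⟨_, (hu.isSolution_iff_isWeakForm hT (.of_forall fun _ _ => rfl)).2 h⟩

end

/-! ### Existence through the projected Euler scheme. -/

section

variable {V : Type*} [Fintype V] [DecidableEq V] {G : WGraph V} {r ε : ℝ} {μ ft : V → ℝ}

/-- The velocity of the unconstrained flow. -/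
def freeFlow (G : WGraph V) (r ε : ℝ) (μ ft u : V → ℝ) (i : V) : ℝ :=
  -(opA G r μ *ᵥ u) i + fidf μ ft i - 1 / (2 * ε) + u i / ε

theorem aceLHS_eq_freeFlow (hε : 0 < ε) (u u' : V → ℝ) (i : V) :
    aceLHS G r ε μ ft u u' i = ε * (u' i - freeFlow G r ε μ ft u i) := by
  simp only [aceLHS, freeFlow, Pi.sub_apply, Pi.add_apply, Pi.smul_apply, smul_eq_mul,
    Pi.one_apply]
  field_simp
  ring

theorem exists_abs_freeFlow_le (hε : 0 < ε) (G : WGraph V) (r : ℝ) (μ ft : V → ℝ) :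
    ∃ C, ∀ u ∈ unitBox V, ∀ i, |freeFlow G r ε μ ft u i| ≤ C := by
  obtain ⟨C, hC⟩ := exists_abs_deriv_le hε G r μ ft
  -- With the free velocity in place of `u'` the left-hand side of the equation is 0, so the
  -- previous velocity bound applies.
  refine ⟨C, fun u hu i => hC u _ hu (fun j => ?_) i⟩
  rw [aceLHS_eq_freeFlow hε, sub_self, mul_zero]
  norm_num

theorem exists_abs_freeFlow_sub_le (hε : 0 < ε) (G : WGraph V) (r : ℝ) (μ ft : V → ℝ) :
    ∃ C, 0 ≤ C ∧ ∀ (u v : V → ℝ) (δ : ℝ), (∀ j, |u j - v j| ≤ δ) → ∀ i,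
      |freeFlow G r ε μ ft u i - freeFlow G r ε μ ft v i| ≤ C * δ := by
  have hnn : ∀ i, 0 ≤ ∑ j, |opA G r μ i j| := fun i => by positivity
  refine ⟨∑ i, ∑ j, |opA G r μ i j| + ε⁻¹, by positivity, fun u v δ h i => ?_⟩
  have e : freeFlow G r ε μ ft u i - freeFlow G r ε μ ft v i =
      -∑ j, opA G r μ i j * (u j - v j) + ε⁻¹ * (u i - v i) := by
    simp only [freeFlow, Matrix.mulVec, dotProduct, mul_sub, Finset.sum_sub_distrib]
    ring
  have hδ : 0 ≤ δ := (abs_nonneg _).trans (h i)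
  rw [e]
  refine (abs_add_le _ _).trans ?_
  rw [add_mul, abs_neg, abs_mul, abs_of_pos (inv_pos.2 hε)]
  refine add_le_add ?_ (mul_le_mul_of_nonneg_left (h i) (inv_pos.2 hε).le)
  refine (Finset.abs_sum_le_sum_abs _ _).trans ?_
  calc ∑ j, |opA G r μ i j * (u j - v j)| ≤ (∑ j, |opA G r μ i j|) * δ := by
        rw [Finset.sum_mul]
        refine Finset.sum_le_sum fun j _ => ?_
        rw [abs_mul]
        exact mul_le_mul_of_nonneg_left (h j) (abs_nonneg _)
    _ ≤ _ := mul_le_mul_of_nonneg_right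
      (Finset.single_le_sum (fun i _ => hnn i) (Finset.mem_univ i)) hδ

/-- The projected Euler scheme with step size `h`. -/
def projEuler {V : Type*} (F : (V → ℝ) → V → ℝ) (u₀ : V → ℝ) (h : ℝ) : ℕ → V → ℝ
  | 0 => u₀
  | n + 1 => fun i => max 0 (min 1 (projEuler F u₀ h n i + h * F (projEuler F u₀ h n) i))

section Scheme

variable {V : Type*} {F : (V → ℝ) → V → ℝ} {u₀ : V → ℝ} {h L Λ : ℝ}

theorem projEuler_mem (hu₀ : u₀ ∈ unitBox V) (n : ℕ) : projEuler F u₀ h n ∈ unitBox V := by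
  cases n with
  | zero => exact hu₀
  | succ n => exact fun i => ⟨le_max_left _ _, max_le zero_le_one (min_le_left _ _)⟩

/-- Projection onto `[0,1]` is nonexpansive and fixes the current iterate. -/
theorem projEuler_succ_sub_le (hu₀ : u₀ ∈ unitBox V) (hh : 0 ≤ h)
    (hL : ∀ u ∈ unitBox V, ∀ i, |F u i| ≤ L) (n : ℕ) (i : V) :
    |projEuler F u₀ h (n + 1) i - projEuler F u₀ h n i| ≤ L * h := by
  have hx := projEuler_mem (F := F) (h := h) hu₀ n i
  set x := projEuler F u₀ h n with hxdef
  have h1 : |max 0 (min 1 (x i + h * F x i)) - max 0 (min 1 (x i))| ≤ |h * F x i| := by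
    refine (abs_max_sub_max_le_max 0 _ 0 _).trans (max_le (by simp; positivity) ?_)
    refine (abs_min_sub_min_le_max 1 _ 1 _).trans ?_
    simp
    positivity
  rw [min_eq_right hx.2, max_eq_right hx.1, abs_mul, abs_of_nonneg hh] at h1
  refine h1.trans ?_
  rw [mul_comm L]
  exact mul_le_mul_of_nonneg_left (hL x (projEuler_mem hu₀ n) i) hh

theorem projEuler_add_sub_le (hu₀ : u₀ ∈ unitBox V) (hh : 0 ≤ h)
    (hL : ∀ u ∈ unitBox V, ∀ i, |F u i| ≤ L) (m k : ℕ) (i : V) :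
    |projEuler F u₀ h (m + k) i - projEuler F u₀ h m i| ≤ L * (k * h) := by
  induction k with
  | zero => simp
  | succ k ih =>
    have h1 := projEuler_succ_sub_le hu₀ hh hL (m + k) i
    have h2 := abs_sub_le (projEuler F u₀ h (m + (k + 1)) i) (projEuler F u₀ h (m + k) i)
      (projEuler F u₀ h m i)
    push_cast
    rw [← add_assoc] at h2 ⊢
    linarith

/-- With `y` the projection of `x + g`, this is the obtuse-angle property `0 ≤ (y - x - g) * (η -
y)`, after the square of `y - x` is dropped. -/
theorem projEuler_step (n : ℕ) (i : V) {η : ℝ} (hη : η ∈ Icc (0 : ℝ) 1) :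
    1 / 2 * (projEuler F u₀ h (n + 1) i - η) ^ 2 - 1 / 2 * (projEuler F u₀ h n i - η) ^ 2 ≤
      h * F (projEuler F u₀ h n) i * (projEuler F u₀ h (n + 1) i - η) := by
  set x := projEuler F u₀ h n i
  set g := h * F (projEuler F u₀ h n) i
  have hy : projEuler F u₀ h (n + 1) i = max 0 (min 1 (x + g)) := rfl
  rw [hy]
  have key : 0 ≤ (max 0 (min 1 (x + g)) - x - g) * (η - max 0 (min 1 (x + g))) := by
    rcases le_total 1 (x + g) with h1 | h1
    · rw [min_eq_left h1, max_eq_right zero_le_one]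
      nlinarith [hη.2]
    · rw [min_eq_right h1]
      rcases le_total 0 (x + g) with h2 | h2
      · rw [max_eq_right h2]; simp
      · rw [max_eq_left h2]
        nlinarith [hη.1]
  nlinarith [sq_nonneg (max 0 (min 1 (x + g)) - x)]

/-- The discrete evolution variational inequality. -/
theorem projEuler_evi (hu₀ : u₀ ∈ unitBox V) (hh : 0 ≤ h) (hL0 : 0 ≤ L) (hΛ0 : 0 ≤ Λ)
    (hL : ∀ u ∈ unitBox V, ∀ i, |F u i| ≤ L)
    (hΛ : ∀ (u v : V → ℝ) (δ : ℝ), (∀ j, |u j - v j| ≤ δ) → ∀ i, |F u i - F v i| ≤ Λ * δ)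
    (m k : ℕ) (i : V) {η : ℝ} (hη : η ∈ Icc (0 : ℝ) 1) :
    1 / 2 * (projEuler F u₀ h (m + k) i - η) ^ 2 - 1 / 2 * (projEuler F u₀ h m i - η) ^ 2 ≤
      (k * h) * (F (projEuler F u₀ h m) i * (projEuler F u₀ h m i - η)) +
        (Λ * L + L * L) * (k * h) ^ 2 := by
  induction k with
  | zero => simp
  | succ k ih =>
    have h1 := projEuler_step (F := F) (u₀ := u₀) (h := h) (m + k) i hη
    have h2 := projEuler_add_sub_le (F := F) hu₀ hh hL m (k + 1) i
    have h3 := hΛ _ _ _ (fun j => projEuler_add_sub_le (F := F) hu₀ hh hL m k j) i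
    have h4 := projEuler_mem (F := F) (h := h) hu₀ (m + (k + 1)) i
    have h5 := hL _ (projEuler_mem (F := F) (h := h) hu₀ m) i
    rw [← add_assoc] at h2 h4 ⊢
    set y := projEuler F u₀ h (m + k + 1) i
    set x := projEuler F u₀ h m i
    set a := F (projEuler F u₀ h (m + k)) i
    set c := F (projEuler F u₀ h m) i
    -- The cost of freezing the velocity and position at step `m`: `Λ * L` comes from the change of
    -- `F`, `L * L` from the displacement.
    have h6 : a * (y - η) - c * (x - η) ≤ (Λ * L + L * L) * ((k + 1) * h) := by
      have e : a * (y - η) - c * (x - η) = (a - c) * (y - η) + c * (y - x) := by ring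
      have h7 : (a - c) * (y - η) ≤ Λ * (L * (k * h)) := by
        refine (le_abs_self _).trans ?_
        rw [abs_mul]
        have : |y - η| ≤ 1 := by
          rw [abs_le]; constructor <;> linarith [h4.1, h4.2, hη.1, hη.2]
        exact (mul_le_of_le_one_right (abs_nonneg _) this).trans h3
      have h8 : c * (y - x) ≤ L * (L * ((k + 1) * h)) := by
        refine (le_abs_self _).trans ?_
        rw [abs_mul]
        push_cast at h2
        exact mul_le_mul h5 h2 (abs_nonneg _) hL0
      have h9 : 0 ≤ Λ * L * h := by positivity
      rw [e]
      nlinarith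
    have h7 := mul_le_mul_of_nonneg_left h6 hh
    -- Slack in `k ^ 2 + (k + 1) ≤ (k + 1) ^ 2`, which closes the induction on the quadratic error.
    have h8 : 0 ≤ (Λ * L + L * L) * (k * h ^ 2) := by positivity
    push_cast
    nlinarith

/-- The limit of the projected Euler scheme: a Lipschitz curve in the unit box that satisfies the
evolution variational inequality up to quadratic terms in the time increment. -/
theorem exists_evi_curve (hu₀ : u₀ ∈ unitBox V) (hL0 : 0 ≤ L) (hΛ0 : 0 ≤ Λ)
    (hL : ∀ u ∈ unitBox V, ∀ i, |F u i| ≤ L)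
    (hΛ : ∀ (u v : V → ℝ) (δ : ℝ), (∀ j, |u j - v j| ≤ δ) → ∀ i, |F u i - F v i| ≤ Λ * δ)
    (hF : Continuous F) :
    ∃ u : ℝ → V → ℝ, u 0 = u₀ ∧ (∀ t, u t ∈ unitBox V) ∧
      (∀ s t, 0 ≤ s → s ≤ t → ∀ i, |u t i - u s i| ≤ L * (t - s)) ∧
      ∀ s t, 0 ≤ s → s ≤ t → ∀ i, ∀ η ∈ Icc (0 : ℝ) 1,
        1 / 2 * (u t i - η) ^ 2 - 1 / 2 * (u s i - η) ^ 2 ≤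
          (t - s) * (F (u s) i * (u s i - η)) + (Λ * L + L * L) * (t - s) ^ 2 := by
  let h : ℕ → ℝ := fun n => 1 / ((n : ℝ) + 1)
  have hpos : ∀ n, 0 < h n := fun n => Nat.one_div_pos_of_nat
  let U : ℕ → ℝ → V → ℝ := fun n t => projEuler F u₀ (h n) ⌊t / h n⌋₊
  -- Compact for pointwise convergence by Tychonoff; a limit along one ultrafilter handles all times
  -- at once, without extracting subsequences.
  let S : Set (ℝ → V → ℝ) := Set.pi univ fun _ => Set.pi univ fun _ => Icc (0 : ℝ) 1
  have hS : IsCompact S := isCompact_univ_pi fun _ => isCompact_univ_pi fun _ => isCompact_Icc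
  have hUS : ∀ n, U n ∈ S := fun n t _ i _ => projEuler_mem hu₀ _ i
  obtain ⟨u, huS, hlim⟩ := hS.ultrafilter_le_nhds' ((hyperfilter ℕ : Ultrafilter ℕ).map U)
    (Ultrafilter.mem_map.2 (Filter.univ_mem' hUS))
  have hU : Tendsto U (hyperfilter ℕ) (𝓝 u) := hlim
  have hUt : ∀ t, Tendsto (fun n => U n t) (hyperfilter ℕ) (𝓝 (u t)) :=
    fun t => tendsto_pi_nhds.1 hU t
  have hUti : ∀ t i, Tendsto (fun n => U n t i) (hyperfilter ℕ) (𝓝 (u t i)) :=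
    fun t i => tendsto_pi_nhds.1 (hUt t) i
  have hh : Tendsto h (hyperfilter ℕ) (𝓝 0) :=
    tendsto_one_div_add_atTop_nhds_zero_nat.mono_left Nat.hyperfilter_le_atTop
  -- The number of steps between two times, multiplied by the step size, is the elapsed time up to
  -- one step.
  have hstep : ∀ n s t, 0 ≤ s → s ≤ t → ∃ k : ℕ, ⌊t / h n⌋₊ = ⌊s / h n⌋₊ + k ∧
      |k * h n - (t - s)| ≤ h n := by
    intro n s t hs hst
    have hn := hpos n
    have hle : ⌊s / h n⌋₊ ≤ ⌊t / h n⌋₊ := Nat.floor_mono (by gcongr)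
    refine ⟨⌊t / h n⌋₊ - ⌊s / h n⌋₊, by omega, ?_⟩
    rw [Nat.cast_sub hle]
    have a1 := Nat.floor_le (show 0 ≤ s / h n by positivity)
    have a2 := Nat.lt_floor_add_one (s / h n)
    have a3 := Nat.floor_le (show 0 ≤ t / h n from div_nonneg (hs.trans hst) hn.le)
    have a4 := Nat.lt_floor_add_one (t / h n)
    rw [le_div_iff₀ hn] at a1 a3
    rw [div_lt_iff₀ hn] at a2 a4
    rw [abs_le]
    constructor <;> nlinarith
  refine ⟨u, ?_, fun t i => huS t (mem_univ _) i (mem_univ _), ?_, ?_⟩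
  · refine tendsto_nhds_unique (hUt 0) ?_
    have : (fun n => U n 0) = fun _ => u₀ := by
      funext n
      simp [U, projEuler]
    rw [this]
    exact tendsto_const_nhds
  · intro s t hs hst i
    have hr : Tendsto (fun n => L * (t - s + h n)) (hyperfilter ℕ) (𝓝 (L * (t - s + 0))) :=
      (tendsto_const_nhds.add hh).const_mul L
    rw [add_zero] at hr
    refine le_of_tendsto_of_tendsto' ((hUti t i).sub (hUti s i)).abs hr fun n => ?_
    obtain ⟨k, hk, hk'⟩ := hstep n s t hs hst
    simp only [U, hk]
    refine (projEuler_add_sub_le hu₀ (hpos n).le hL _ k i).trans ?_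
    exact mul_le_mul_of_nonneg_left (by linarith [(abs_le.1 hk').2]) hL0
  · intro s t hs hst i η hη
    have hFs : Tendsto (fun n => F (U n s) i) (hyperfilter ℕ) (𝓝 (F (u s) i)) :=
      tendsto_pi_nhds.1 ((hF.tendsto _).comp (hUt s)) i
    have hl := ((((hUti t i).sub_const η).pow 2).const_mul (1 / 2)).sub
      ((((hUti s i).sub_const η).pow 2).const_mul (1 / 2))
    -- The term `L * h n` pays for replacing `k * h n` by `t - s` in the linear term.
    have hr : Tendsto (fun n => (t - s) * (F (U n s) i * (U n s i - η)) + L * h n +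
        (Λ * L + L * L) * (t - s + h n) ^ 2) (hyperfilter ℕ)
        (𝓝 ((t - s) * (F (u s) i * (u s i - η)) + L * 0 +
          (Λ * L + L * L) * (t - s + 0) ^ 2)) :=
      (((hFs.mul ((hUti s i).sub_const η)).const_mul _).add (hh.const_mul L)).add
        (((tendsto_const_nhds.add hh).pow 2).const_mul _)
    rw [mul_zero, add_zero, add_zero] at hr
    refine le_of_tendsto_of_tendsto' hl hr fun n => ?_
    obtain ⟨k, hk, hk'⟩ := hstep n s t hs hst
    have hevi := projEuler_evi hu₀ (hpos n).le hL0 hΛ0 hL hΛ ⌊s / h n⌋₊ k i hη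
    rw [← hk] at hevi
    change 1 / 2 * (U n t i - η) ^ 2 - 1 / 2 * (U n s i - η) ^ 2 ≤
      (k * h n) * (F (U n s) i * (U n s i - η)) + (Λ * L + L * L) * (k * h n) ^ 2 at hevi
    refine hevi.trans (add_le_add ?_ ?_)
    · have h1 : |F (U n s) i * (U n s i - η)| ≤ L := by
        have h2 := hUS n s (mem_univ _) i (mem_univ _)
        have h3 : |U n s i - η| ≤ 1 := by
          rw [abs_le]; constructor <;> linarith [h2.1, h2.2, hη.1, hη.2]
        rw [abs_mul]
        exact (mul_le_of_le_one_right (abs_nonneg _) h3).trans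
          (hL _ (fun j => hUS n s (mem_univ _) j (mem_univ _)) i)
      have h2 : (k * h n - (t - s)) * (F (U n s) i * (U n s i - η)) ≤ h n * L := by
        refine (le_abs_self _).trans ?_
        rw [abs_mul]
        exact mul_le_mul hk' h1 (abs_nonneg _) (hpos n).le
      linarith
    · refine mul_le_mul_of_nonneg_left ?_ (by positivity)
      exact pow_le_pow_left₀ (by have := hpos n; positivity) (by linarith [(abs_le.1 hk').2]) 2

end Scheme

/-- Right difference quotients are at most `c + C * (s - t)`, and the remainder vanishes in the
limit. -/
theorem HasDerivAt.le_of_forall_gt {g : ℝ → ℝ} {g' t c C : ℝ} (hg : HasDerivAt g g' t)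
    (h : ∀ s, t < s → g s - g t ≤ (s - t) * c + C * (s - t) ^ 2) : g' ≤ c := by
  have h1 : Tendsto (slope g t) (𝓝[>] t) (𝓝 g') :=
    (hasDerivAt_iff_tendsto_slope.1 hg).mono_left (nhdsWithin_mono _ fun x hx => ne_of_gt hx)
  have h2 : Tendsto (fun s => c + C * (s - t)) (𝓝[>] t) (𝓝 (c + C * (t - t))) :=
    (Continuous.tendsto (by fun_prop) t).mono_left nhdsWithin_le_nhds
  rw [sub_self, mul_zero, add_zero] at h2
  refine le_of_tendsto_of_tendsto h1 h2 ?_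
  filter_upwards [self_mem_nhdsWithin] with s hs
  have hs' : 0 < s - t := sub_pos.2 hs
  rw [slope_def_field, div_le_iff₀ hs']
  nlinarith [h s hs]

theorem exists_isSolution [Nontrivial V] (hε : 0 < ε) {T : Set ℝ} (hT : IsTimeInterval T)
    {u₀ : V → ℝ} (hu₀ : u₀ ∈ unitBox V) :
    ∃ u β : ℝ → V → ℝ, IsSolution G r ε μ ft T u β ∧ u 0 = u₀ := by
  obtain ⟨L, hL⟩ := exists_abs_freeFlow_le hε G r μ ft
  obtain ⟨Λ, hΛ0, hΛ⟩ := exists_abs_freeFlow_sub_le hε G r μ ft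
  have hL0 : 0 ≤ L := (abs_nonneg _).trans (hL u₀ hu₀ (Classical.arbitrary V))
  have hF : Continuous (freeFlow G r ε μ ft) := by
    unfold freeFlow Matrix.mulVec dotProduct
    fun_prop
  obtain ⟨u, hu0, hbox, hlip, hevi⟩ := exists_evi_curve hu₀ hL0 hΛ0 hL hΛ hF
  have hlip' : ∀ i, LipschitzOnWith L.toNNReal (fun t => u t i) (Ici 0) := by
    intro i
    refine LipschitzOnWith.of_dist_le_mul fun s hs t ht => ?_
    rw [Real.coe_toNNReal _ hL0, Real.dist_eq, Real.dist_eq]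
    rcases le_total s t with h | h
    · rw [abs_sub_comm, abs_sub_comm s, abs_of_nonneg (sub_nonneg.2 h)]
      exact hlip s t hs h i
    · rw [abs_of_nonneg (sub_nonneg.2 h)]
      exact hlip t s ht h i
  let u' : ℝ → V → ℝ := fun t i => deriv (fun s => u s i) t
  have hA : ∀ b ∈ T, ∀ i, ACD (fun t => u t i) (fun t => u' t i) 0 b := by
    intro b hb i
    have h1 : AbsolutelyContinuousOnInterval (fun t => u t i) 0 b :=
      ((hlip' i).mono (by
        rw [uIcc_of_le (hT.nonneg hb)]; exact Icc_subset_Ici_self)).absolutelyContinuousOnInterval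
    exact ⟨h1, h1.ae_differentiableAt.mono fun t ht hm => (ht hm).hasDerivAt⟩
  have hbd : ∀ᵐ t, t ∈ T → ∀ i, |u' t i| ≤ L := by
    filter_upwards [ae_ne_real 0] with t ht hm i
    have := norm_deriv_le_of_lipschitzOn
      (Ici_mem_nhds (lt_of_le_of_ne (hT.nonneg hm) (Ne.symm ht))) (hlip' i)
    rwa [Real.coe_toNNReal _ hL0] at this
  have htr : IsTrajectory G r T u u' := .of_acd hT (fun t _ => hbox t) hA hbd
  have hw : IsWeakForm G r ε μ ft T u u' := by
    rw [IsWeakForm, hT.ae_iff]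
    filter_upwards [htr.ae_hasDerivAt hT] with t h1 hm η hη
    refine Finset.sum_nonneg fun i _ => mul_nonneg ?_ (G.deg_rpow_pos i r).le
    have h2 : HasDerivAt (fun s => 1 / 2 * (u s i - η i) ^ 2) ((u t i - η i) * u' t i) t := by
      refine ((((h1 hm i).sub_const (η i)).pow 2).const_mul (1 / 2 : ℝ)).congr_deriv ?_
      norm_num
      ring
    -- Differentiating the evolution inequality at `t` gives the variational inequality vertex by
    -- vertex.
    have h3 := h2.le_of_forall_gt fun s hs => hevi t s (hT.nonneg hm) (le_of_lt hs) i _ (hη i)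
    rw [aceLHS_eq_freeFlow hε, Pi.sub_apply]
    nlinarith
  obtain ⟨β, hβ⟩ := (htr.exists_isSolution_iff_isWeakForm hT).2 hw
  exact ⟨u, β, hβ, hu0⟩

end

/-! ### Spectral lower bound and dependence on initial data. -/

section

variable {V : Type*} [Fintype V] [DecidableEq V] {G : WGraph V} {r ε : ℝ} {μ ft : V → ℝ}
  {T : Set ℝ} {u u' v v' β γ : ℝ → V → ℝ}

/-! ### The smallest eigenvalue -/

omit [DecidableEq V] in
theorem ipV_self_pos [Nontrivial V] {x : V → ℝ} (hx : x ≠ 0) : 0 < ipV G r x x := by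
  obtain ⟨i, hi⟩ := Function.ne_iff.1 hx
  exact Finset.sum_pos' (fun i _ => mul_nonneg (mul_self_nonneg _) (G.deg_rpow_pos i r).le)
    ⟨i, Finset.mem_univ i, mul_pos (mul_self_pos.2 hi) (G.deg_rpow_pos i r)⟩

theorem ipV_opA_mulVec [Nontrivial V] (x y : V → ℝ) :
    ipV G r (opA G r μ *ᵥ x) y =
      1 / 2 * ∑ i, ∑ j, G.wt i j * ((y i - y j) * (x i - x j)) +
        ∑ i, G.deg i ^ r * (μ i * x i * y i) := by
  rw [← G.sum_mul_sum_wt, ← Finset.sum_add_distrib, ipV]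
  refine Finset.sum_congr rfl fun i _ => ?_
  have h : G.deg i ^ r * G.deg i ^ (-r) = 1 := by
    rw [← Real.rpow_add (G.deg_pos i), add_neg_cancel, Real.rpow_zero]
  rw [opA_mulVec]
  linear_combination (y i * ∑ j, G.wt i j * (x i - x j)) * h

theorem ipV_opA_mulVec_comm [Nontrivial V] (x y : V → ℝ) :
    ipV G r (opA G r μ *ᵥ x) y = ipV G r (opA G r μ *ᵥ y) x := by
  rw [ipV_opA_mulVec, ipV_opA_mulVec]
  congr 2
  · refine Finset.sum_congr rfl fun i _ => Finset.sum_congr rfl fun j _ => ?_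
    ring
  · refine funext fun i => ?_
    ring

/-- The operator `D^{r/2} A D^{-r/2}` on Euclidean space. -/
def symmOpA (G : WGraph V) (r : ℝ) (μ : V → ℝ) :
    EuclideanSpace ℝ V →ₗ[ℝ] EuclideanSpace ℝ V where
  toFun y := WithLp.toLp 2 fun i =>
    √(G.deg i ^ r) * (opA G r μ *ᵥ fun j => (√(G.deg j ^ r))⁻¹ * y j) i
  map_add' x y := by
    ext i
    have : (fun j => (√(G.deg j ^ r))⁻¹ * (x + y) j) =
        (fun j => (√(G.deg j ^ r))⁻¹ * x j) + fun j => (√(G.deg j ^ r))⁻¹ * y j := by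
      ext j; simp [mul_add]
    change √(G.deg i ^ r) * (opA G r μ *ᵥ fun j => (√(G.deg j ^ r))⁻¹ * (x + y) j) i = _
    rw [this, Matrix.mulVec_add, Pi.add_apply, mul_add]
    rfl
  map_smul' c x := by
    ext i
    have : (fun j => (√(G.deg j ^ r))⁻¹ * (c • x) j) =
        c • fun j => (√(G.deg j ^ r))⁻¹ * x j := by
      ext j; simp; ring
    change √(G.deg i ^ r) * (opA G r μ *ᵥ fun j => (√(G.deg j ^ r))⁻¹ * (c • x) j) i = _
    rw [this, Matrix.mulVec_smul, Pi.smul_apply, smul_eq_mul, mul_left_comm]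
    rfl

/-- `A` is self-adjoint only for the weighted inner product; conjugation by `D^{r/2}` is an isometry
onto Euclidean space, where the spectral theory of symmetric operators applies. -/
theorem inner_symmOpA [Nontrivial V] (x y : EuclideanSpace ℝ V) :
    inner ℝ (symmOpA G r μ x) y =
      ipV G r (opA G r μ *ᵥ fun j => (√(G.deg j ^ r))⁻¹ * x j)
        (fun j => (√(G.deg j ^ r))⁻¹ * y j) := by
  rw [PiLp.inner_apply, ipV]
  refine Finset.sum_congr rfl fun i _ => ?_
  have h1 : 0 < √(G.deg i ^ r) := Real.sqrt_pos.2 (G.deg_rpow_pos i r)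
  have h2 : G.deg i ^ r = √(G.deg i ^ r) * √(G.deg i ^ r) :=
    (Real.mul_self_sqrt (G.deg_rpow_pos i r).le).symm
  simp only [symmOpA, LinearMap.coe_mk, AddHom.coe_mk, RCLike.inner_apply, conj_trivial]
  set s := √(G.deg i ^ r)
  rw [h2]
  field_simp

/-- The infimum of the Rayleigh quotient of a symmetric operator in finite dimension is an
eigenvalue. The quadratic bound shows that it is the least one and also drives the stability
estimate. -/
theorem exists_isLeast_eigs [Nontrivial V] (G : WGraph V) (r : ℝ) (μ : V → ℝ) :
    ∃ ξ, IsLeast (eigs (opA G r μ)) ξ ∧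
      ∀ x : V → ℝ, ξ * ipV G r x x ≤ ipV G r (opA G r μ *ᵥ x) x := by
  have hs : ∀ i, 0 < √(G.deg i ^ r) := fun i => Real.sqrt_pos.2 (G.deg_rpow_pos i r)
  set S := symmOpA G r μ with hS
  have hsymm : S.IsSymmetric := fun x y => by
    rw [hS, inner_symmOpA, real_inner_comm, inner_symmOpA, ipV_opA_mulVec_comm]
  have heig := hsymm.hasEigenvalue_iInf_of_finiteDimensional
  set ξ : ℝ := ⨅ x : {x : EuclideanSpace ℝ V // x ≠ 0},
    RCLike.re (inner ℝ (S x) (x : EuclideanSpace ℝ V)) / ‖(x : EuclideanSpace ℝ V)‖ ^ 2 with hξ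
  -- A real infimum lies below the members of the family only when the family is bounded below; the
  -- operator norm provides the bound.
  have hbdd : BddBelow (range fun x : {x : EuclideanSpace ℝ V // x ≠ 0} =>
      RCLike.re (inner ℝ (S x) (x : EuclideanSpace ℝ V)) /
        ‖(x : EuclideanSpace ℝ V)‖ ^ 2) := by
    refine ⟨-‖S.toContinuousLinearMap‖, ?_⟩
    rintro _ ⟨⟨x, hx⟩, rfl⟩
    have hx' : 0 < ‖x‖ := norm_pos_iff.2 hx
    simp only [RCLike.re_to_real]
    rw [le_div_iff₀ (by positivity)]
    have h1 := (abs_le.1 (abs_real_inner_le_norm (S x) x)).1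
    have h2 := S.toContinuousLinearMap.le_opNorm x
    rw [LinearMap.coe_toContinuousLinearMap'] at h2
    nlinarith
  have hquad : ∀ x : V → ℝ, ξ * ipV G r x x ≤ ipV G r (opA G r μ *ᵥ x) x := by
    intro x
    rcases eq_or_ne x 0 with rfl | hx
    · simp [ipV]
    let y : EuclideanSpace ℝ V := WithLp.toLp 2 fun i => √(G.deg i ^ r) * x i
    have hyx : (fun j => (√(G.deg j ^ r))⁻¹ * y j) = x := by
      ext j
      simp only [y]
      rw [← mul_assoc, inv_mul_cancel₀ (hs j).ne', one_mul]
    have hy : y ≠ 0 := fun h => hx (by rw [← hyx, h]; ext; simp)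
    have h1 : ξ ≤ inner ℝ (S y) y / ‖y‖ ^ 2 := ciInf_le hbdd ⟨y, hy⟩
    have h2 : ‖y‖ ^ 2 = ipV G r x x := by
      rw [EuclideanSpace.norm_sq_eq, ipV]
      refine Finset.sum_congr rfl fun i _ => ?_
      simp only [y, norm_mul, Real.norm_eq_abs, mul_pow, sq_abs,
        Real.sq_sqrt (G.deg_rpow_pos i r).le]
      ring
    rw [hS, inner_symmOpA, hyx, h2, le_div_iff₀ (ipV_self_pos hx)] at h1
    exact h1
  refine ⟨ξ, ⟨?_, ?_⟩, hquad⟩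
  · obtain ⟨y, hy⟩ := heig.exists_hasEigenvector
    have h1 := hy.apply_eq_smul
    set x : V → ℝ := fun j => (√(G.deg j ^ r))⁻¹ * y j with hx
    have hyx : ∀ j, y j = √(G.deg j ^ r) * x j := fun j => by
      rw [hx, ← mul_assoc, mul_inv_cancel₀ (hs j).ne', one_mul]
    refine Module.End.hasEigenvalue_of_hasEigenvector (x := x)
      ⟨Module.End.mem_eigenspace_iff.2 ?_, fun h0 => hy.2 ?_⟩
    · rw [Matrix.toLin'_apply]
      ext i
      have h2 := congrArg (fun z : EuclideanSpace ℝ V => z i) h1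
      simp only [hS, symmOpA, LinearMap.coe_mk, AddHom.coe_mk, PiLp.smul_apply, smul_eq_mul] at h2
      rw [hyx i, mul_left_comm] at h2
      exact mul_left_cancel₀ (hs i).ne' h2
    · ext j
      rw [hyx j, h0]
      simp
  · intro l hl
    obtain ⟨x, hx⟩ := Module.End.HasEigenvalue.exists_hasEigenvector hl
    have h1 := hx.apply_eq_smul
    rw [Matrix.toLin'_apply] at h1
    have h2 := hquad x
    have h3 : ipV G r (l • x) x = l * ipV G r x x := by
      rw [ipV, ipV, Finset.mul_sum]
      refine Finset.sum_congr rfl fun i _ => ?_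
      rw [Pi.smul_apply, smul_eq_mul]; ring
    rw [h1, h3] at h2
    exact le_of_mul_le_mul_right h2 (ipV_self_pos hx.2)

/-! ### Well-posedness -/

theorem eq_freeFlow_add_div (hε : 0 < ε) {x x' b : V → ℝ} (h : aceLHS G r ε μ ft x x' = b)
    (i : V) : x' i = freeFlow G r ε μ ft x i + b i / ε := by
  have h1 := congrFun h i
  rw [aceLHS_eq_freeFlow hε] at h1
  rw [← h1]
  field_simp
  ring

theorem sum_mul_deriv_sub_le [Nontrivial V] (hε : 0 < ε) {ξ : ℝ}
    (hξ : ∀ x : V → ℝ, ξ * ipV G r x x ≤ ipV G r (opA G r μ *ᵥ x) x)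
    {x x' b y y' c : V → ℝ} (hx : aceLHS G r ε μ ft x x' = b) (hb : b ∈ setB x)
    (hy : aceLHS G r ε μ ft y y' = c) (hc : c ∈ setB y) :
    ∑ i, G.deg i ^ r * (2 * (x i - y i) * (x' i - y' i)) ≤
      (2 * (1 / ε - ξ)) * ipV G r (x - y) (x - y) := by
  rw [mem_setB_iff] at hb hc
  have hA := hξ (x - y)
  have e : ∑ i, G.deg i ^ r * (2 * (x i - y i) * (x' i - y' i)) =
      2 * (1 / ε * ipV G r (x - y) (x - y) - ipV G r (opA G r μ *ᵥ (x - y)) (x - y)) +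
        2 / ε * ∑ i, G.deg i ^ r * ((x i - y i) * (b i - c i)) := by
    simp only [ipV, Finset.mul_sum, ← Finset.sum_sub_distrib, ← Finset.sum_add_distrib]
    refine Finset.sum_congr rfl fun i _ => ?_
    rw [eq_freeFlow_add_div hε hx i, eq_freeFlow_add_div hε hy i]
    simp only [freeFlow, Matrix.mulVec_sub, Pi.sub_apply]
    ring
  -- Monotonicity of the subdifferential: the multiplier at the larger value is nonpositive, the one
  -- at the smaller value nonnegative.
  have h2 : ∑ i, G.deg i ^ r * ((x i - y i) * (b i - c i)) ≤ 0 := by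
    refine Finset.sum_nonpos fun i _ =>
      mul_nonpos_of_nonneg_of_nonpos (G.deg_rpow_pos i r).le ?_
    obtain ⟨hx1, hb1, hb2⟩ := hb i
    obtain ⟨hy1, hc1, hc2⟩ := hc i
    rcases lt_trichotomy (x i) (y i) with h | h | h
    · have := hb1 (h.trans_le hy1.2)
      have := hc2 (hx1.1.trans_lt h)
      exact mul_nonpos_of_nonpos_of_nonneg (by linarith) (by linarith)
    · simp [h]
    · have := hc1 (h.trans_le hx1.2)
      have := hb2 (hy1.1.trans_lt h)
      exact mul_nonpos_of_nonneg_of_nonpos (by linarith) (by linarith)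
  have h3 := mul_nonpos_of_nonneg_of_nonpos (show 0 ≤ 2 / ε by positivity) h2
  rw [e]
  linarith

theorem IsSolution.normV_sub_le [Nontrivial V] (hT : IsTimeInterval T) (hε : 0 < ε) {ξ : ℝ}
    (hξ : ∀ x : V → ℝ, ξ * ipV G r x x ≤ ipV G r (opA G r μ *ᵥ x) x)
    (hu : IsSolution G r ε μ ft T u β) (hv : IsSolution G r ε μ ft T v γ) {t : ℝ} (ht : t ∈ T) :
    normV G r (u t - v t) ≤
      Real.exp (-ξ * t) * Real.exp (t / ε) * normV G r (u 0 - v 0) := by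
  obtain ⟨u', hu, hβ⟩ := hu
  obtain ⟨v', hv, hγ⟩ := hv
  rw [hT.ae_iff] at hβ hγ
  have h0t := hT.nonneg ht
  have hA : ACD (fun s => ∑ i, G.deg i ^ r * (u s i - v s i) ^ 2)
      (fun s => ∑ i, G.deg i ^ r * (2 * (u s i - v s i) * (u' s i - v' s i))) 0 t :=
    ACD.sum _ fun i _ => ((((hu.acd hT hT.zero_mem ht h0t i).sub
      (hv.acd hT hT.zero_mem ht h0t i)).sq).const_mul _)
  have e : ∀ s, ∑ i, G.deg i ^ r * (u s i - v s i) ^ 2 = ipV G r (u s - v s) (u s - v s) := by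
    intro s
    refine Finset.sum_congr rfl fun i _ => ?_
    rw [Pi.sub_apply]; ring
  simp only [e] at hA
  have h1 := hA.le_exp_mul (c := 2 * (1 / ε - ξ)) h0t (by
    filter_upwards [hβ, hγ] with s hs1 hs2 hm
    have hsT := hT.Icc_subset hT.zero_mem ht hm
    exact sum_mul_deriv_sub_le hε hξ (hs1 hsT).1 (hs1 hsT).2 (hs2 hsT).1 (hs2 hsT).2)
  rw [← Real.exp_add]
  refine (Real.sqrt_le_sqrt h1).trans_eq ?_
  -- Gronwall controls the squared norm; the square root halves the rate.
  have e2 : Real.exp (2 * (1 / ε - ξ) * (t - 0)) = Real.exp (-ξ * t + t / ε) ^ 2 := by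
    rw [← Real.exp_nat_mul]
    congr 1
    push_cast
    ring
  rw [e2, Real.sqrt_mul (sq_nonneg _), Real.sqrt_sq (Real.exp_pos _).le, normV]

end

/-! ### Matrix exponentials and the explicit formula. -/

section

variable {V : Type*} [Fintype V]

theorem intervalIntegrable_pi_iff {F : ℝ → V → ℝ} {a b : ℝ} :
    IntervalIntegrable F volume a b ↔ ∀ i, IntervalIntegrable (fun s => F s i) volume a b := by
  simp only [IntervalIntegrable, IntegrableOn, integrable_pi_iff, forall_and]

theorem intervalIntegral_apply {F : ℝ → V → ℝ} {a b : ℝ} (h : IntervalIntegrable F volume a b)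
    (i : V) : (∫ s in a..b, F s) i = ∫ s in a..b, F s i :=
  ((ContinuousLinearMap.proj (R := ℝ) (φ := fun _ : V => ℝ) i).intervalIntegral_comp_comm h).symm

theorem intervalIntegral_mulVec {F : ℝ → V → ℝ} {a b : ℝ}
    (h : IntervalIntegrable F volume a b) (M : Matrix V V ℝ) :
    ∫ s in a..b, M *ᵥ F s = M *ᵥ ∫ s in a..b, F s :=
  (Matrix.mulVecLin M).toContinuousLinearMap.intervalIntegral_comp_comm h

theorem intervalIntegrable_const_add_smul {β : ℝ → V → ℝ} {a b : ℝ}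
    (hβ : IntervalIntegrable β volume a b) (c : V → ℝ) (k : ℝ) : IntervalIntegrable (fun s => c + k • β s) volume a b :=
  intervalIntegrable_const.add (hβ.smul k)

variable [DecidableEq V]

section Exp

open scoped Matrix.Norms.Operator

theorem hasDerivAt_exp_smul_apply (B : Matrix V V ℝ) (t : ℝ) (i j : V) :
    HasDerivAt (fun t : ℝ => NormedSpace.exp (t • B) i j) ((B * NormedSpace.exp (t • B)) i j) t :=
  (Matrix.entryLinearMap ℝ ℝ i j).toContinuousLinearMap.hasFDerivAt.comp_hasDerivAt t
    (hasDerivAt_exp_smul_const' (𝕂 := ℝ) B t)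

end Exp

theorem contDiff_exp_smul_apply (B : Matrix V V ℝ) (i j : V) :
    ContDiff ℝ 1 (fun t : ℝ => NormedSpace.exp (t • B) i j) := by
  rw [contDiff_one_iff_deriv]
  refine ⟨fun t => (hasDerivAt_exp_smul_apply B t i j).differentiableAt, ?_⟩
  have : deriv (fun t : ℝ => NormedSpace.exp (t • B) i j) =
      fun t => ∑ k, B i k * NormedSpace.exp (t • B) k j :=
    funext fun t => (hasDerivAt_exp_smul_apply B t i j).deriv
  rw [this]
  refine continuous_finsetSum _ fun k _ => continuous_const.mul ?_
  exact (show Differentiable ℝ (fun t : ℝ => NormedSpace.exp (t • B) k j) from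
    fun t => (hasDerivAt_exp_smul_apply B t k j).differentiableAt).continuous

theorem exp_neg_smul_mul (B : Matrix V V ℝ) (t : ℝ) :
    NormedSpace.exp (-t • B) * NormedSpace.exp (t • B) = 1 := by
  rw [← Matrix.exp_add_of_commute _ _ (((Commute.refl B).smul_left _).smul_right _), neg_smul,
    neg_add_cancel, NormedSpace.exp_zero]

theorem exp_sub_smul (B : Matrix V V ℝ) (t s : ℝ) :
    NormedSpace.exp (-(t - s) • B) = NormedSpace.exp (-t • B) * NormedSpace.exp (s • B) := by
  rw [← Matrix.exp_add_of_commute _ _ (((Commute.refl B).smul_left _).smul_right _), ← add_smul]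
  congr 2
  ring

theorem commute_exp_smul (B : Matrix V V ℝ) (t : ℝ) :
    B * NormedSpace.exp (t • B) = NormedSpace.exp (t • B) * B :=
  (((Commute.refl B).smul_right t).exp_right).eq

/-- The integrating factor: if `p' = -B p + h`, the derivative collapses to `exp (t • B) *ᵥ h`. -/
theorem acd_exp_mulVec (B : Matrix V V ℝ) {p p' : ℝ → V → ℝ} {a b : ℝ}
    (hp : ∀ i, ACD (fun t => p t i) (fun t => p' t i) a b) (i : V) :
    ACD (fun t => (NormedSpace.exp (t • B) *ᵥ p t) i)
      (fun t => (NormedSpace.exp (t • B) *ᵥ (B *ᵥ p t + p' t)) i) a b := by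
  have h := ACD.sum Finset.univ fun j (_ : j ∈ Finset.univ) =>
    (ACD.of_contDiff (a := a) (b := b) (contDiff_exp_smul_apply B i j) fun t =>
      hasDerivAt_exp_smul_apply B t i j).mul (hp j)
  refine h.congr_deriv (.of_forall fun t _ => ?_)
  rw [Finset.sum_add_distrib, Matrix.mulVec_add, Matrix.mulVec_mulVec, ← commute_exp_smul]
  rfl

theorem intervalIntegrable_exp_mulVec (B : Matrix V V ℝ) {h : ℝ → V → ℝ} {a b : ℝ}
    (hh : IntervalIntegrable h volume a b) :
    IntervalIntegrable (fun s => NormedSpace.exp (s • B) *ᵥ h s) volume a b := by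
  rw [intervalIntegrable_pi_iff] at hh ⊢
  intro i
  have := IntervalIntegrable.sum (μ := volume) (a := a) (b := b) Finset.univ
    (f := fun j s => NormedSpace.exp (s • B) i j * h s j) fun j _ =>
    (hh j).continuousOn_mul (contDiff_exp_smul_apply B i j).continuous.continuousOn
  have e : (fun s => (NormedSpace.exp (s • B) *ᵥ h s) i) =
      ∑ j, fun s => NormedSpace.exp (s • B) i j * h s j := by
    ext s
    simp [Matrix.mulVec, dotProduct]
  rw [e]
  exact this

/-- Variation of constants for `p' = -B p + h`. -/
theorem eq_exp_mulVec_of_acd (B : Matrix V V ℝ) {p h : ℝ → V → ℝ} {b : ℝ}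
    (hh : IntervalIntegrable h volume 0 b)
    (hp : ∀ i, ACD (fun t => p t i) (fun t => (-(B *ᵥ p t) + h t) i) 0 b) :
    p b = NormedSpace.exp (-b • B) *ᵥ (p 0 + ∫ s in (0 : ℝ)..b, NormedSpace.exp (s • B) *ᵥ h s) := by
  have key : NormedSpace.exp (b • B) *ᵥ p b =
      p 0 + ∫ s in (0 : ℝ)..b, NormedSpace.exp (s • B) *ᵥ h s := by
    ext i
    have h1 := (acd_exp_mulVec B hp i).integral_eq
    simp only [add_neg_cancel_left] at h1
    rw [Pi.add_apply, intervalIntegral_apply (intervalIntegrable_exp_mulVec B hh), h1]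
    simp
  rw [← key, Matrix.mulVec_mulVec, exp_neg_smul_mul, Matrix.one_mulVec]

theorem acd_of_eq_exp_mulVec (B : Matrix V V ℝ) {p h : ℝ → V → ℝ} {b : ℝ} (hb : 0 ≤ b) {p₀ : V → ℝ}
    (hh : IntervalIntegrable h volume 0 b)
    (hp : ∀ t ∈ Icc 0 b, p t =
      NormedSpace.exp (-t • B) *ᵥ (p₀ + ∫ s in (0 : ℝ)..t, NormedSpace.exp (s • B) *ᵥ h s))
    (i : V) : ACD (fun t => p t i) (fun t => (-(B *ᵥ p t) + h t) i) 0 b := by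
  have hE := intervalIntegrable_exp_mulVec B hh
  have hq : ∀ i, ACD (fun t => (p₀ + ∫ s in (0 : ℝ)..t, NormedSpace.exp (s • B) *ᵥ h s) i)
      (fun t => (NormedSpace.exp (t • B) *ᵥ h t) i) 0 b := by
    intro i
    refine .of_primitive (intervalIntegrable_pi_iff.1 hE i) fun t ht => ?_
    rw [uIcc_of_le hb] at ht
    have hEt : IntervalIntegrable (fun s => NormedSpace.exp (s • B) *ᵥ h s) volume 0 t :=
      hE.mono_set (by rw [uIcc_of_le hb, uIcc_of_le ht.1]; exact Icc_subset_Icc le_rfl ht.2)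
    rw [Pi.add_apply, Pi.add_apply, intervalIntegral_apply hEt, intervalIntegral.integral_same]
    simp
  -- The bracket has derivative `exp (t • B) *ᵥ h`; the product rule for `-B` cancels that
  -- exponential and recovers the differential equation.
  have h1 := acd_exp_mulVec (-B) hq i
  simp only [smul_neg, ← neg_smul] at h1
  refine (h1.congr fun t ht => ?_).congr_deriv (.of_forall fun t ht => ?_)
  · rw [uIcc_of_le hb] at ht
    exact (congrFun (hp t ht) i).symm
  · rw [uIcc_of_le hb] at ht
    rw [hp t ht]
    set q := p₀ + ∫ s in (0 : ℝ)..t, NormedSpace.exp (s • B) *ᵥ h s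
    rw [Matrix.mulVec_add, Matrix.mulVec_mulVec (h t), exp_neg_smul_mul,
      Matrix.one_mulVec, Matrix.neg_mulVec, Matrix.mulVec_neg, Matrix.mulVec_mulVec q,
      Matrix.mulVec_mulVec q, commute_exp_smul]

/-- The curve `exp (s • B) *ᵥ (B⁻¹ *ᵥ c)` is a primitive of the integrand. -/
theorem intervalIntegral_exp_mulVec_const {B : Matrix V V ℝ} (hB : IsUnit B.det) (c : V → ℝ)
    (t : ℝ) : ∫ s in (0 : ℝ)..t, NormedSpace.exp (s • B) *ᵥ c =
      NormedSpace.exp (t • B) *ᵥ (B⁻¹ *ᵥ c) - B⁻¹ *ᵥ c := by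
  ext i
  have h1 := (acd_exp_mulVec B (p := fun _ => B⁻¹ *ᵥ c) (p' := fun _ => 0)
    (fun i => ACD.const ((B⁻¹ *ᵥ c) i) 0 t) i).integral_eq
  simp only [add_zero, Matrix.mulVec_mulVec c, Matrix.mul_nonsing_inv B hB,
    Matrix.one_mulVec] at h1
  rw [intervalIntegral_apply (intervalIntegrable_exp_mulVec B intervalIntegrable_const), h1]
  simp

variable {G : WGraph V} {r ε : ℝ} {μ ft : V → ℝ} {T : Set ℝ} {u u' β : ℝ → V → ℝ}

theorem isUnit_det_opB (h : ε⁻¹ ∉ eigs (opA G r μ)) : IsUnit (opB G r ε μ).det := by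
  rw [isUnit_iff_ne_zero]
  intro h0
  obtain ⟨x, hx, hBx⟩ := Matrix.exists_mulVec_eq_zero_iff.2 h0
  refine h (Module.End.hasEigenvalue_of_hasEigenvector (x := x)
    ⟨Module.End.mem_eigenspace_iff.2 ?_, hx⟩)
  rw [Matrix.toLin'_apply]
  rwa [opB, Matrix.sub_mulVec, Matrix.smul_mulVec, Matrix.one_mulVec, sub_eq_zero] at hBx

/-- Factoring `exp (-t • B)` out and moving the constant forcing under the integral gives the form
that variation of constants produces. -/
theorem duhamel_eq (h : ε⁻¹ ∉ eigs (opA G r μ)) (u₀ : V → ℝ) {t : ℝ}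
    (hβ : IntervalIntegrable β volume 0 t) :
    duhamel G r ε μ ft u₀ β t = NormedSpace.exp (-t • opB G r ε μ) *ᵥ
      (u₀ + ∫ s in (0 : ℝ)..t, NormedSpace.exp (s • opB G r ε μ) *ᵥ
        ((fidf μ ft - (1 / (2 * ε)) • (1 : V → ℝ)) + (1 / ε) • β s)) := by
  have hB := isUnit_det_opB h
  rw [duhamel]
  set B := opB G r ε μ
  set c := fidf μ ft - (1 / (2 * ε)) • (1 : V → ℝ)
  have hβ' := intervalIntegrable_exp_mulVec B hβ
  have hβs : IntervalIntegrable (fun s => (1 / ε) • NormedSpace.exp (s • B) *ᵥ β s) volume 0 t :=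
    hβ'.smul (1 / ε)
  simp only [exp_sub_smul, ← Matrix.mulVec_mulVec, Matrix.mulVec_add, Matrix.mulVec_smul]
  rw [intervalIntegral_mulVec hβ', intervalIntegral.integral_add
    (intervalIntegrable_exp_mulVec B intervalIntegrable_const) hβs,
    intervalIntegral.integral_smul, intervalIntegral_exp_mulVec_const hB]
  simp only [Matrix.mulVec_add, Matrix.mulVec_sub, Matrix.mulVec_smul]
  rw [← add_assoc]
  congr 2
  rw [Matrix.mulVec_mulVec _ (NormedSpace.exp (-t • B)) (NormedSpace.exp (t • B)),
    exp_neg_smul_mul, Matrix.one_mulVec, Matrix.sub_mulVec, Matrix.one_mulVec,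
    Matrix.mulVec_sub, Matrix.mulVec_mulVec c, Matrix.mulVec_mulVec c]
  congr 2
  calc B⁻¹ * NormedSpace.exp (-t • B)
      = B⁻¹ * (NormedSpace.exp (-t • B) * B) * B⁻¹ := by
        rw [Matrix.mul_assoc, Matrix.mul_assoc, Matrix.mul_nonsing_inv B hB, Matrix.mul_one]
    _ = NormedSpace.exp (-t • B) * B⁻¹ := by
        rw [← commute_exp_smul, ← Matrix.mul_assoc, Matrix.nonsing_inv_mul B hB, Matrix.one_mul]

theorem freeFlow_add_div_eq (u b : V → ℝ) (i : V) :
    freeFlow G r ε μ ft u i + b i / ε = (-(opB G r ε μ *ᵥ u) +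
      ((fidf μ ft - (1 / (2 * ε)) • (1 : V → ℝ)) + (1 / ε) • b)) i := by
  simp only [freeFlow, opB, Matrix.sub_mulVec, Matrix.smul_mulVec, Matrix.one_mulVec,
    Pi.add_apply, Pi.neg_apply, Pi.sub_apply, Pi.smul_apply, smul_eq_mul, Pi.one_apply]
  ring

theorem isSolution_iff_duhamel [Nontrivial V] (hT : IsTimeInterval T) (hε : 0 < ε)
    (hμ : ∀ i, 0 ≤ μ i) (hft : ft ∈ unitBox V) (h : ε⁻¹ ∉ eigs (opA G r μ))
    (hbox : ∀ t ∈ T, u t ∈ unitBox V) :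
    IsSolution G r ε μ ft T u β ↔
      (∀ᵐ t, t ∈ T → β t ∈ setB (u t) ∧ ∀ i, β t i ∈ Icc (-1 / 2 : ℝ) (1 / 2)) ∧
      (∀ t ∈ T, IntervalIntegrable β volume 0 t) ∧
      ∀ t ∈ T, u t = duhamel G r ε μ ft (u 0) β t := by
  constructor
  · rintro ⟨u', hu, hβ⟩
    rw [hT.ae_iff] at hβ
    have hA := fun {t : ℝ} (ht : t ∈ T) i => hu.acd hT hT.zero_mem ht (hT.nonneg ht) i
    have hint : ∀ t ∈ T, IntervalIntegrable β volume 0 t := by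
      intro t ht
      rw [intervalIntegrable_pi_iff]
      intro i
      have hc : ContinuousOn (fun s => freeFlow G r ε μ ft (u s) i) (uIcc 0 t) := by
        have hcu := fun j => (hA ht j).continuousOn
        unfold freeFlow Matrix.mulVec dotProduct
        fun_prop
      -- Integrability of `β` is inherited from the equation: a.e. it equals `ε` times an integrable
      -- velocity minus a continuous one.
      refine (((hA ht i).intervalIntegrable.sub hc.intervalIntegrable).const_mul ε).congr_ae ?_
      rw [Filter.EventuallyEq, ae_restrict_iff' measurableSet_uIoc]
      filter_upwards [hβ] with s hs hm
      rw [uIoc_of_le (hT.nonneg ht)] at hm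
      rw [← (hs (hT.Icc_subset hT.zero_mem ht (Ioc_subset_Icc_self hm))).1,
        aceLHS_eq_freeFlow hε]
    refine ⟨?_, hint, fun t ht => ?_⟩
    · filter_upwards [hβ, hu.ae_abs_le_half hT hε hμ hft hβ] with t h1 h2 hm
      exact ⟨(h1 hm).2, h2 hm⟩
    · rw [duhamel_eq h _ (hint t ht)]
      refine eq_exp_mulVec_of_acd _ (intervalIntegrable_const_add_smul (hint t ht) _ _) fun i => ?_
      refine (hA ht i).congr_deriv ?_
      filter_upwards [hβ] with s hs hm
      rw [uIcc_of_le (hT.nonneg ht)] at hm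
      rw [← freeFlow_add_div_eq]
      exact eq_freeFlow_add_div hε (hs (hT.Icc_subset hT.zero_mem ht hm)).1 i
  · rintro ⟨hβ, hint, hD⟩
    obtain ⟨C, hC⟩ := exists_abs_deriv_le hε G r μ ft
    -- The velocity is defined by the equation, which thus holds identically; the bound on `β` then
    -- makes it bounded, hence locally square integrable.
    let u' : ℝ → V → ℝ := fun t i => freeFlow G r ε μ ft (u t) i + β t i / ε
    have hace : ∀ t, aceLHS G r ε μ ft (u t) (u' t) = β t := by
      intro t
      ext i
      rw [aceLHS_eq_freeFlow hε]
      simp only [u']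
      field_simp
      ring
    refine ⟨u', .of_acd hT hbox (fun b hb i => ?_) (C := C) ?_, hT.ae_iff.2 ?_⟩
    · have hsub : ∀ t ∈ Icc 0 b, t ∈ T := fun t ht => hT.Icc_subset hT.zero_mem hb ht
      have e : (fun t => u' t i) = fun t => (-(opB G r ε μ *ᵥ u t) +
          ((fidf μ ft - (1 / (2 * ε)) • (1 : V → ℝ)) + (1 / ε) • β t)) i :=
        funext fun t => freeFlow_add_div_eq (u t) (β t) i
      rw [e]
      refine acd_of_eq_exp_mulVec (opB G r ε μ) (hT.nonneg hb) (p₀ := u 0)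
        (intervalIntegrable_const_add_smul (hint b hb) _ _) (fun t ht => ?_) i
      rw [← duhamel_eq h _ (hint t (hsub t ht))]
      exact hD t (hsub t ht)
    · filter_upwards [hβ] with t ht hm
      exact hC _ _ (hbox t hm) fun i => by rw [hace]; exact (ht hm).2 i
    · filter_upwards [hβ] with t ht hm
      exact ⟨hace t, (ht hm).1⟩

end

end GraphACE

end

theorem theorem2p4 {V : Type*} [Fintype V] [DecidableEq V] [Nontrivial V]
    (G : WGraph V) (r : ℝ) (hr : r ∈ Set.Icc (0 : ℝ) 1) (ε : ℝ) (hε : 0 < ε)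
    (μ ft : V → ℝ) (hμ : ∀ i, 0 ≤ μ i) (hμ0 : μ ≠ 0) (hft : ft ∈ unitBox V)
    (T : Set ℝ) (hT : (∃ T₀ : ℝ, 0 ≤ T₀ ∧ T = Set.Icc 0 T₀) ∨ T = Set.Ici 0) :
    -- (a) existence
    (∀ u₀ ∈ unitBox V, ∃ u β : ℝ → V → ℝ, IsSolution G r ε μ ft T u β ∧ u 0 = u₀) ∧
    -- (b) comparison principle
    (∀ u u' β v v' γ : ℝ → V → ℝ, IsTrajectory G r T u u' → IsTrajectory G r T v v' →
      (∀ᵐ t ∂(volume.restrict T),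
        β t ≤ aceLHS G r ε μ ft (u t) (u' t) ∧ β t ∈ setB (u t)) →
      (∀ᵐ t ∂(volume.restrict T),
        aceLHS G r ε μ ft (v t) (v' t) ≤ γ t ∧ γ t ∈ setB (v t)) →
      v 0 ≤ u 0 → ∀ t ∈ T, v t ≤ u t) ∧
    -- (c) uniqueness
    (∀ u β v γ : ℝ → V → ℝ, IsSolution G r ε μ ft T u β → IsSolution G r ε μ ft T v γ →
      u 0 = v 0 → (∀ t ∈ T, u t = v t) ∧ ∀ᵐ t ∂(volume.restrict T), β t = γ t) ∧
    -- (d) the energy decreases along solutions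
    (∀ u β : ℝ → V → ℝ, IsSolution G r ε μ ft T u β →
      AntitoneOn (fun t => energy G r ε μ ft (u t)) T) ∧
    -- (e) weak form
    (∀ u u' : ℝ → V → ℝ, IsTrajectory G r T u u' →
      ((∃ β : ℝ → V → ℝ, IsSolution G r ε μ ft T u β) ↔ IsWeakForm G r ε μ ft T u u') ∧
      (∀ β : ℝ → V → ℝ,
        (∀ᵐ t ∂(volume.restrict T), β t = aceLHS G r ε μ ft (u t) (u' t)) →
        (IsSolution G r ε μ ft T u β ↔ IsWeakForm G r ε μ ft T u u'))) ∧
    -- (f) explicit form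
    (ε⁻¹ ∉ eigs (opA G r μ) → ∀ u β : ℝ → V → ℝ, (∀ t ∈ T, u t ∈ unitBox V) →
      (IsSolution G r ε μ ft T u β ↔
        (∀ᵐ t ∂(volume.restrict T),
          β t ∈ setB (u t) ∧ ∀ i, β t i ∈ Set.Icc (-1 / 2 : ℝ) (1 / 2)) ∧
        (∀ t ∈ T, IntervalIntegrable β volume 0 t) ∧
        ∀ t ∈ T, u t = duhamel G r ε μ ft (u 0) β t)) ∧
    -- (g) Lipschitz regularity
    (ε⁻¹ ∉ eigs (opA G r μ) → ∀ u β : ℝ → V → ℝ, IsSolution G r ε μ ft T u β →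
      ∃ K : ℝ, ∀ s ∈ T, ∀ t ∈ T, normV G r (u t - u s) ≤ K * |t - s|) ∧
    -- (h) well-posedness, where `ξ₁` is the minimum of `σ(A)`
    (ε⁻¹ ∉ eigs (opA G r μ) → ∃ ξ₁ : ℝ, IsLeast (eigs (opA G r μ)) ξ₁ ∧
      ∀ u₀ ∈ unitBox V, ∀ v₀ ∈ unitBox V, ∀ u β v γ : ℝ → V → ℝ,
        IsSolution G r ε μ ft T u β → IsSolution G r ε μ ft T v γ → u 0 = u₀ → v 0 = v₀ →
        ∀ t ∈ T, normV G r (u t - v t) ≤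
          Real.exp (-ξ₁ * t) * Real.exp (t / ε) * normV G r (u₀ - v₀)) := by
  have hT' : IsTimeInterval T := hT
  refine ⟨fun u₀ hu₀ => exists_isSolution hε hT' hu₀, ?_, ?_, ?_, ?_, ?_, ?_, ?_⟩
  · intro u u' β v v' γ hu hv hβ hγ h0 t ht
    exact hu.comparison hT' hε hμ hv (hT'.ae_iff.1 hβ) (hT'.ae_iff.1 hγ) h0 ht
  · intro u β v γ hu hv h0
    obtain ⟨h1, h2⟩ := hu.unique hT' hε hμ hv h0
    exact ⟨h1, hT'.ae_iff.2 h2⟩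
  · exact fun u β hu => hu.antitoneOn_energy hT' hε
  · exact fun u u' hu => ⟨hu.exists_isSolution_iff_isWeakForm hT',
      fun β hβ => hu.isSolution_iff_isWeakForm hT' (hT'.ae_iff.1 hβ)⟩
  · intro h u β hbox
    rw [hT'.ae_iff]
    exact isSolution_iff_duhamel hT' hε hμ hft h hbox
  · exact fun _ u β hu => hu.lipschitz hT' hε hμ hft
  · intro _
    obtain ⟨ξ, hξ, hquad⟩ := exists_isLeast_eigs G r μ
    refine ⟨ξ, hξ, ?_⟩
    rintro _ - _ - u β v γ hu hv rfl rfl t ht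
    exact hu.normV_sub_le hT' hε hquad hv ht
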